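/- Let $(R,\mathfrak m,k)$ be a commutative noetherian local ring that is $\mathfrak m$-adically complete and whose residue field $k=R/\mathfrak m$ is algebraically closed. Let $Q$ be a finite quiver and let $RQ$ be its path algebra, where $pq$ means first $q$, then $p$. For $\ell\ge 0$ let $A_\ell$ be the $R$-span of the paths of length $\ell$, let $A=\bigoplus_{\ell\ge1}A_\ell$, and let $\mathfrak mQ$ be the set of $R$-linear combinations of paths with coefficients in $\mathfrak m$. Call a two-sided ideal $I$ of $RQ$ *weakly admissible* if (a) $I\subseteq A+\mathfrak mQ$ and $I\cap A\subseteq A^2+(\mathfrak mQ\cap A)$, and (b) $A^m\subseteq I+\mathfrak mQ$ and $\mathfrak mQ\subseteq I+\sum_{\ell=1}^nA_\ell$ for some integers $m,n>0$. Call $I$ *admissible* (in the sense of Raggi-Cárdenas and Salmerón) if it is weakly admissible and the canonical map $R\to RQ/I$ is injective. A ring $\Gamma$ with Jacobson radical $J$ is *semiperfect* if $\Gamma/J$ is semisimple artinian and idempotents lift modulo $J$; it is *basic* if it is semiperfect and $\Gamma/J$ is a product of division rings. An idempotent $e\in\Gamma$ is *local* if $Je$ is the unique maximal submodule of the left module $\Gamma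 e$. The *Gabriel quiver* of a basic module-finite $R$-algebra $\Gamma$ has vertices $v$ indexing a complete orthogonal set of local idempotents $e_v$ of $\Gamma$, and the number of arrows from $u$ to $v$ is the multiplicity of $\Gamma e_v$ as a direct summand of the projective cover of $Je_u$. (1) Let $\Gamma$ be a basic $R$-algebra that is finitely generated as an $R$-module and has Gabriel quiver $Q$. Then there is a surjective $R$-algebra homomorphism $RQ\to\Gamma$ whose kernel is weakly admissible; if moreover the structure map $R\to\Gamma$ is injective, the kernel is admissible. (2) If $I$ is a weakly admissible two-sided ideal of $RQ$ (in particular, if $I$ is admissible), then $RQ/I$ is finitely generated as an $R$-module, semiperfect, basic, and has Gabriel quiver $Q$. -/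

import Mathlib

open Function

noncomputable section

/-! ### Path algebras -/

/-- A path in the quiver `V`, together with its tail (source) and its head (target).
Trivial paths are included. -/
structure QPath (V : Type*) [Quiver V] where
  tail : V
  head : V
  path : Quiver.Path tail head

namespace QPath

variable {V : Type*} [Quiver V]

/-- The trivial path at a vertex. -/
def triv (v : V) : QPath V := ⟨v, v, Quiver.Path.nil⟩

/-- The length of a path. -/
def length (p : QPath V) : ℕ := p.path.length

/-- The composition `p q` (first `q`, then `p`) of paths with `t(p) = h(q)`. -/
def comp (p q : QPath V) (h : q.head = p.tail) : QPath V :=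
  ⟨q.tail, p.head, q.path.comp (Quiver.Path.cast h.symm rfl p.path)⟩

theorem comp_assoc (p q r : QPath V) (h : q.head = p.tail) (h' : r.head = q.tail) :
    (p.comp q h).comp r h' = p.comp (q.comp r h') h := by
  obtain ⟨a, b, p⟩ := p
  obtain ⟨c, d, q⟩ := q
  obtain ⟨e, f, r⟩ := r
  dsimp only at h h'
  subst h h'
  simp [comp, Quiver.Path.comp_assoc]

theorem triv_comp (q : QPath V) (v : V) (h : q.head = v) : (triv v).comp q h = q := by
  obtain ⟨c, d, q⟩ := q
  dsimp only at h
  subst h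
  simp [comp, triv]

theorem comp_triv (p : QPath V) (v : V) (h : v = p.tail) : p.comp (triv v) h = p := by
  obtain ⟨c, d, p⟩ := p
  dsimp only at h
  subst h
  simp [comp, triv]

end QPath

/-- The path algebra `RQ` of a quiver `Q` (with vertex type `V`): the free `R`-module on the set of
paths. A term of this type is a finitely supported family `(r_p)`, read as `∑ r_p p`. -/
def PathAlgebra (R V : Type*) [CommRing R] [Quiver V] : Type _ := QPath V →₀ R

namespace PathAlgebra

variable {R V : Type*} [CommRing R] [Quiver V]

instance : AddCommGroup (PathAlgebra R V) := inferInstanceAs (AddCommGroup (QPath V →₀ R))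

instance : Module R (PathAlgebra R V) := inferInstanceAs (Module R (QPath V →₀ R))

variable (R) in
/-- A path, as an element of the path algebra. -/
def ofPath (p : QPath V) : PathAlgebra R V := Finsupp.single p (1 : R)

/-- The coefficient of a path in an element of the path algebra. -/
def coeff (p : QPath V) : PathAlgebra R V →ₗ[R] R := Finsupp.lapply p

/-- The paths form an `R`-basis of the path algebra. -/
def pathBasis : Module.Basis (QPath V) R (PathAlgebra R V) := Finsupp.basisSingleOne

@[simp] theorem pathBasis_apply (p : QPath V) :
    (pathBasis p : PathAlgebra R V) = ofPath R p := by
  simp only [pathBasis, ofPath]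
  exact congrFun Finsupp.coe_basisSingleOne p

open Classical in
variable (R) in
/-- The product of two paths: the composition `p q` if `t(p) = h(q)`, and `0` otherwise. -/
def mulPath (p q : QPath V) : PathAlgebra R V :=
  if h : q.head = p.tail then ofPath R (p.comp q h) else 0

/-- The `R`-bilinear extension of the product of paths. -/
def mulLin : PathAlgebra R V →ₗ[R] PathAlgebra R V →ₗ[R] PathAlgebra R V :=
  pathBasis.constr R fun p => pathBasis.constr R fun q => mulPath R p q

instance : Mul (PathAlgebra R V) := ⟨fun x y => mulLin x y⟩

theorem mul_def (x y : PathAlgebra R V) : x * y = mulLin x y := rfl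

theorem ofPath_mul_ofPath (p q : QPath V) :
    (ofPath R p * ofPath R q : PathAlgebra R V) = mulPath R p q := by
  rw [mul_def, ← pathBasis_apply p, ← pathBasis_apply q, mulLin, Module.Basis.constr_basis,
    Module.Basis.constr_basis]

theorem mulPath_assoc (p q r : QPath V) :
    (mulPath R p q * ofPath R r : PathAlgebra R V) = ofPath R p * mulPath R q r := by
  by_cases h : q.head = p.tail <;> by_cases h' : r.head = q.tail
  · have e1 : mulPath R p q = ofPath R (p.comp q h) := dif_pos h
    have e2 : mulPath R q r = ofPath R (q.comp r h') := dif_pos h'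
    rw [e1, e2, ofPath_mul_ofPath, ofPath_mul_ofPath]
    have e3 : mulPath R (p.comp q h) r = ofPath R ((p.comp q h).comp r h') := dif_pos h'
    have e4 : mulPath R p (q.comp r h') = ofPath R (p.comp (q.comp r h') h) := dif_pos h
    rw [e3, e4, QPath.comp_assoc]
  · have e1 : mulPath R p q = ofPath R (p.comp q h) := dif_pos h
    have e2 : mulPath R q r = 0 := dif_neg h'
    have e3 : mulPath R (p.comp q h) r = 0 := dif_neg h'
    rw [e1, e2, ofPath_mul_ofPath, e3, mul_def, map_zero]
  · have e1 : mulPath R p q = 0 := dif_neg h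
    have e2 : mulPath R q r = ofPath R (q.comp r h') := dif_pos h'
    have e4 : mulPath R p (q.comp r h') = 0 := dif_neg h
    rw [e1, e2, ofPath_mul_ofPath, e4, mul_def, map_zero, LinearMap.zero_apply]
  · have e1 : mulPath R p q = 0 := dif_neg h
    have e2 : mulPath R q r = 0 := dif_neg h'
    rw [e1, e2, mul_def, mul_def, map_zero, map_zero, LinearMap.zero_apply]

/-- Induction principle: an additive and homogeneous property of paths holds everywhere. -/
theorem induction_path {P : PathAlgebra R V → Prop} (x : PathAlgebra R V)
    (hp : ∀ p, P (ofPath R p)) (h0 : P 0) (ha : ∀ x y, P x → P y → P (x + y))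
    (hs : ∀ (r : R) x, P x → P (r • x)) : P x := by
  have hx : x ∈ Submodule.span R (Set.range (pathBasis : Module.Basis (QPath V) R _)) := by
    rw [Module.Basis.span_eq]
    trivial
  induction hx using Submodule.span_induction with
  | mem x h =>
    obtain ⟨p, rfl⟩ := h
    rw [pathBasis_apply]
    exact hp p
  | zero => exact h0
  | add x y _ _ hx hy => exact ha x y hx hy
  | smul r x _ hx => exact hs r x hx

theorem add_mul' (x y z : PathAlgebra R V) : (x + y) * z = x * z + y * z := by
  simp only [mul_def, map_add, LinearMap.add_apply]

theorem mul_add' (x y z : PathAlgebra R V) : x * (y + z) = x * y + x * z := by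
  simp only [mul_def, map_add]

theorem smul_mul' (r : R) (x y : PathAlgebra R V) : (r • x) * y = r • (x * y) := by
  simp only [mul_def, map_smul, LinearMap.smul_apply]

theorem mul_smul' (r : R) (x y : PathAlgebra R V) : x * (r • y) = r • (x * y) := by
  simp only [mul_def, map_smul]

theorem zero_mul' (x : PathAlgebra R V) : 0 * x = 0 := by
  simp only [mul_def, map_zero, LinearMap.zero_apply]

theorem mul_zero' (x : PathAlgebra R V) : x * 0 = 0 := by
  simp only [mul_def, map_zero]

theorem mul_assoc' (x y z : PathAlgebra R V) : x * y * z = x * (y * z) := by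
  induction x using induction_path with
  | h0 => simp only [zero_mul']
  | ha x x' hx hx' => simp only [add_mul', hx, hx']
  | hs r x hx => simp only [smul_mul', hx]
  | hp p =>
    induction y using induction_path with
    | h0 => simp only [zero_mul', mul_zero']
    | ha y y' hy hy' => simp only [add_mul', mul_add', hy, hy']
    | hs r y hy => simp only [smul_mul', mul_smul', hy]
    | hp q =>
      induction z using induction_path with
      | h0 => simp only [mul_zero']
      | ha z z' hz hz' => simp only [mul_add', hz, hz']
      | hs r z hz => simp only [mul_smul', hz]
      | hp s => rw [ofPath_mul_ofPath, ofPath_mul_ofPath, mulPath_assoc]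

variable [Fintype V]

instance : One (PathAlgebra R V) := ⟨∑ v : V, ofPath R (QPath.triv v)⟩

theorem one_def : (1 : PathAlgebra R V) = ∑ v : V, ofPath R (QPath.triv v) := rfl

theorem one_mul' (x : PathAlgebra R V) : 1 * x = x := by
  induction x using induction_path with
  | h0 => exact mul_zero' _
  | ha x y hx hy => rw [mul_add', hx, hy]
  | hs r x hx => rw [mul_smul', hx]
  | hp p =>
    rw [one_def, mul_def, map_sum, LinearMap.sum_apply, Finset.sum_eq_single p.head]
    · rw [← mul_def, ofPath_mul_ofPath]
      have e : mulPath R (QPath.triv p.head) p = ofPath R ((QPath.triv p.head).comp p rfl) :=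
        dif_pos rfl
      exact e.trans (congrArg (ofPath R) (QPath.triv_comp p _ rfl))
    · intro v _ hv
      rw [← mul_def, ofPath_mul_ofPath]
      exact dif_neg fun h => hv h.symm
    · intro h
      exact absurd (Finset.mem_univ _) h

theorem mul_one' (x : PathAlgebra R V) : x * 1 = x := by
  induction x using induction_path with
  | h0 => exact zero_mul' _
  | ha x y hx hy => rw [add_mul', hx, hy]
  | hs r x hx => rw [smul_mul', hx]
  | hp p =>
    rw [one_def, mul_def, map_sum, Finset.sum_eq_single p.tail]
    · rw [← mul_def, ofPath_mul_ofPath]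
      have e : mulPath R p (QPath.triv p.tail) = ofPath R (p.comp (QPath.triv p.tail) rfl) :=
        dif_pos rfl
      exact e.trans (congrArg (ofPath R) (QPath.comp_triv p _ rfl))
    · intro v _ hv
      rw [← mul_def, ofPath_mul_ofPath]
      exact dif_neg fun h => hv h
    · intro h
      exact absurd (Finset.mem_univ _) h

instance : Ring (PathAlgebra R V) :=
  { (inferInstance : AddCommGroup (PathAlgebra R V)) with
    mul := (· * ·)
    one := 1
    left_distrib := mul_add'
    right_distrib := add_mul'
    zero_mul := zero_mul'
    mul_zero := mul_zero'
    mul_assoc := mul_assoc'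
    one_mul := one_mul'
    mul_one := mul_one' }

instance : Algebra R (PathAlgebra R V) :=
  Algebra.ofModule smul_mul' (fun r x y => mul_smul' r x y)

end PathAlgebra

/-! ### Admissible ideals of path algebras -/

namespace PathAlgebra

section Admissible

variable (R V : Type*) [CommRing R] [Quiver V]

/-- `A_ℓ`, the `R`-span of the paths of length `ℓ`. -/
def lengthSpan (l : ℕ) : Submodule R (PathAlgebra R V) :=
  Submodule.span R {x | ∃ p : QPath V, p.length = l ∧ x = ofPath R p}

/-- `A = ⨁_{ℓ ≥ 1} A_ℓ`, the `R`-span of the non-trivial paths. It is a two-sided ideal. -/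
def arrowIdeal : Submodule R (PathAlgebra R V) :=
  ⨆ l : ℕ, ⨆ _ : 1 ≤ l, lengthSpan R V l

/-- `𝔪Q`, the `R`-linear combinations of paths with coefficients in the maximal ideal `𝔪`. -/
def maxIdealSpan [IsLocalRing R] : Submodule R (PathAlgebra R V) where
  carrier := {x | ∀ p : QPath V, coeff p x ∈ IsLocalRing.maximalIdeal R}
  add_mem' hx hy p := by
    rw [map_add]
    exact Ideal.add_mem _ (hx p) (hy p)
  zero_mem' p := by
    rw [map_zero]
    exact Ideal.zero_mem _
  smul_mem' r x hx p := by
    rw [map_smul, smul_eq_mul]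
    exact Ideal.mul_mem_left _ _ (hx p)

variable {R V}
variable [IsLocalRing R] [Fintype V]

/-- `I ⊆ A + 𝔪Q` and `I ∩ A ⊆ A² + 𝔪Q ∩ A`. -/
def IsBoundedAbove (I : Ideal (PathAlgebra R V)) : Prop :=
  I.restrictScalars R ≤ arrowIdeal R V ⊔ maxIdealSpan R V ∧
    I.restrictScalars R ⊓ arrowIdeal R V ≤
      arrowIdeal R V ^ 2 ⊔ (maxIdealSpan R V ⊓ arrowIdeal R V)

/-- `A^m ⊆ I + 𝔪Q` and `𝔪Q ⊆ I + ∑_{ℓ=1}^n A_ℓ` for some integers `m, n > 0`. -/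
def IsBoundedBelow (I : Ideal (PathAlgebra R V)) : Prop :=
  ∃ m n : ℕ, 0 < m ∧ 0 < n ∧
    arrowIdeal R V ^ m ≤ I.restrictScalars R ⊔ maxIdealSpan R V ∧
    maxIdealSpan R V ≤ I.restrictScalars R ⊔ ⨆ l ∈ Finset.Icc 1 n, lengthSpan R V l

/-- Admissibility in the wide sense: bounded above and bounded below. -/
def IsWeaklyAdmissible (I : Ideal (PathAlgebra R V)) : Prop :=
  IsBoundedAbove I ∧ IsBoundedBelow I

/-- Admissibility in the (stricter) sense of Raggi-Cárdenas and Salmerón: bounded above, bounded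
below, and the canonical map `R → RQ/I` is injective. -/
def IsAdmissible (I : Ideal (PathAlgebra R V)) [I.IsTwoSided] : Prop :=
  IsWeaklyAdmissible I ∧ Injective (algebraMap R (PathAlgebra R V ⧸ I))

end Admissible

end PathAlgebra

/-! ### Semiperfect rings, basic rings, and the Gabriel quiver -/

section Rings

universe u

variable (Γ : Type u) [Ring Γ]

/-- `Γ/J` is semisimple, and idempotents lift modulo the Jacobson radical `J`. -/
def IsSemiperfect : Prop :=
  IsSemisimpleRing (Γ ⧸ Ring.jacobson Γ) ∧
    ∀ x : Γ, x * x - x ∈ Ring.jacobson Γ → ∃ f : Γ, IsIdempotentElem f ∧ x - f ∈ Ring.jacobson Γ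

/-- A basic ring: a semiperfect ring `Γ` such that `Γ/J` is a (finite) product of division
rings. -/
def IsBasic : Prop :=
  IsSemiperfect Γ ∧ ∃ (n : ℕ) (D : Fin n → Type u) (_ : ∀ i, DivisionRing (D i)),
    Nonempty ((Γ ⧸ Ring.jacobson Γ) ≃+* ∀ i, D i)

variable {Γ}

/-- For a left ideal `N` of `Γ` and `e ∈ Γ`, the left ideal `N e = {x e | x ∈ N}`. -/
def mulRightIdeal (N : Ideal Γ) (e : Γ) : Ideal Γ :=
  Submodule.map (LinearMap.toSpanSingleton Γ Γ e) N

/-- A local idempotent `e`: the left module `Γ e` has `J e` as its unique maximal submodule. -/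
def IsLocalIdempotent (e : Γ) : Prop :=
  IsIdempotentElem e ∧
    ∀ N : Ideal Γ, N ⋖ mulRightIdeal ⊤ e ↔ N = mulRightIdeal (Ring.jacobson Γ) e

/-- A projective cover: a surjection from a projective module with superfluous kernel. -/
def IsProjectiveCover {P M : Type*} [AddCommGroup P] [Module Γ P] [AddCommGroup M] [Module Γ M]
    (π : P →ₗ[Γ] M) : Prop :=
  Module.Projective Γ P ∧ Surjective π ∧
    ∀ N : Submodule Γ P, N ⊔ LinearMap.ker π = ⊤ → N = ⊤

/-- The finite quiver with vertex type `V` is the Gabriel quiver of `Γ`: its vertices index a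
complete orthogonal set of local idempotents `e_v` of `Γ`, and for all vertices `u`, `v` the
number of arrows from `u` to `v` is the multiplicity of `Γ e_v` as a summand of the projective cover
of `J e_u`. That is, the direct sum, over the arrows `u → v` with tail `u`, of the modules `Γ e_v`
is a projective cover of `J e_u`. -/
def IsGabrielQuiver (V : Type*) [Quiver V] [Fintype V] (Γ : Type u) [Ring Γ] : Prop :=
  ∃ e : V → Γ, CompleteOrthogonalIdempotents e ∧ (∀ v, IsLocalIdempotent (e v)) ∧
    ∀ u : V, ∃ π : (DirectSum (Σ v : V, (u ⟶ v)) fun a => mulRightIdeal (⊤ : Ideal Γ) (e a.1))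
        →ₗ[Γ] mulRightIdeal (Ring.jacobson Γ) (e u),
      IsProjectiveCover π

end Rings

end

/-! Both directions rest on one dictionary: vertices are the local idempotents, and the arrows with
tail `u` give a generating family of `J e_u` that is minimal modulo `J`. Condition (a) on `I` says
that vertices and arrows stay independent modulo the radical; condition (b) says that `RQ/I` is
finite over `R` and that its radical comes from `A`.

From `I` to `RQ/I`: paths of length at least `m` lie in `I + 𝔪Q`, hence in `I` plus a span of
bounded length, so the quotient is finite. Sending arrows to zero and reducing vertex coefficients
modulo `𝔪` gives a surjection `RQ/I → k^V`, whose kernel is the image of `A`. That kernel is exactly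
`J`: it contains `J` because `k^V` has zero radical, and it lies in `J` because its `m`-th power
lies in `𝔪(RQ/I) ⊆ J` (`mem_jacobson_quotient_iff`). Idempotents lift to sums of vertices. The
arrows generate `J e_u`, and `I ∩ A ⊆ A² + (𝔪Q ∩ A)` makes every relation among them have
coefficients in `J`, so the resulting map is a projective cover (`isGabrielQuiver_of_generators`).

From `Γ` to `I`: projective covers of the `J e_u` supply an element `γ_a` for each arrow
(`IsGabrielQuiver.exists_generators`), hence `φ : RQ → Γ`. Since `k` is algebraically closed, `Γ e_v
/ J e_v` is spanned over `R` by `e_v`, so `Γ = im φ + J`. Iterating `J = ∑ Γ γ_a` gives `Γ = im φ +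
J^n` for all `n ≥ 1`; as some `J^n ⊆ 𝔪Γ`, Nakayama over `R` makes `φ` surjective. Superfluity of the
kernels of the covers gives (a), and `J^m ⊆ 𝔪Γ` together with the noetherian property of `Γ` over
`R` gives (b). -/

noncomputable section

/-! ### Paths: lengths and splitting off the first arrow. -/

namespace QPath

variable {V : Type*} [Quiver V]

/-- The path of length one given by an arrow. -/
def ofArrow {u v : V} (a : u ⟶ v) : QPath V := ⟨u, v, a.toPath⟩

@[simp] theorem length_triv (v : V) : (triv v).length = 0 := rfl

@[simp] theorem length_ofArrow {u v : V} (a : u ⟶ v) : (ofArrow a).length = 1 := rfl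

@[simp] theorem length_comp (p q : QPath V) (h : q.head = p.tail) :
    (p.comp q h).length = p.length + q.length := by
  obtain ⟨a, b, p⟩ := p
  obtain ⟨c, d, q⟩ := q
  dsimp only at h
  subst h
  simp [comp, length, add_comm]

theorem eq_triv_of_length_eq_zero (p : QPath V) (h : p.length = 0) : p = triv p.tail := by
  obtain ⟨a, b, p⟩ := p
  obtain rfl := Quiver.Path.eq_of_length_zero p h
  obtain rfl := Quiver.Path.eq_nil_of_length_zero p h
  rfl

/-- A nontrivial path is an arrow followed by a path. -/
theorem exists_eq_comp_ofArrow (p : QPath V) (h : 1 ≤ p.length) :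
    ∃ (v : V) (a : p.tail ⟶ v) (q : QPath V) (hq : (ofArrow a).head = q.tail),
      p = q.comp (ofArrow a) hq ∧ q.length + 1 = p.length := by
  obtain ⟨u, w, p⟩ := p
  obtain ⟨n, hn⟩ : ∃ n, p.length = n + 1 := ⟨p.length - 1, by simp [length] at h; omega⟩
  obtain ⟨v, a, q, rfl, hqn⟩ := Quiver.Path.eq_toPath_comp_of_length_eq_succ p hn
  refine ⟨v, a, ⟨v, w, q⟩, rfl, ?_, ?_⟩
  · exact congrArg (QPath.mk u w) hqn
  · exact hn.symm

theorem ofArrow_injective : Injective fun a : (Σ u v : V, (u ⟶ v)) => ofArrow a.2.2 := by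
  rintro ⟨u, v, a⟩ ⟨u', v', a'⟩ h
  simp only [ofArrow, QPath.mk.injEq] at h
  obtain ⟨rfl, rfl, h⟩ := h
  have h := Quiver.Path.hom_heq_of_cons_eq_cons (eq_of_heq h)
  rw [eq_of_heq h]

theorem finite_length_eq [Finite V] [∀ u v : V, Finite (u ⟶ v)] (n : ℕ) :
    {p : QPath V | p.length = n}.Finite := by
  induction n with
  | zero =>
    refine (Set.finite_range (triv : V → QPath V)).subset fun p hp => ?_
    exact ⟨_, (eq_triv_of_length_eq_zero p hp).symm⟩
  | succ n ih =>
    have : Finite {p : QPath V | p.length = n} := ih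
    classical
    -- Paths of length `n + 1` are values of a map on the finite set of pairs (arrow, path of length
    -- `n`); the `else` branch is a junk value for pairs that do not compose.
    refine (Set.finite_range fun x : (Σ u v : V, (u ⟶ v)) × {p : QPath V | p.length = n} =>
      if h : (ofArrow x.1.2.2).head = x.2.1.tail then x.2.1.comp (ofArrow x.1.2.2) h else x.2.1).subset ?_
    intro p hp
    obtain ⟨v, a, q, hq, h, hl⟩ := exists_eq_comp_ofArrow p (by rw [hp]; omega)
    refine ⟨⟨⟨p.tail, v, a⟩, ⟨q, by simp only [Set.mem_ofPred_eq] at hp ⊢; omega⟩⟩, ?_⟩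
    simp only [dif_pos hq]
    exact h.symm

end QPath

/-! ### Coefficients and the powers of the arrow ideal. -/

namespace PathAlgebra

section Coeff

variable {R V : Type*} [CommRing R] [Quiver V]

theorem coeff_ofPath [DecidableEq (QPath V)] (p q : QPath V) :
    coeff p (ofPath R q) = if q = p then 1 else 0 := by
  exact Finsupp.single_apply

@[simp] theorem coeff_ofPath_self (p : QPath V) : coeff p (ofPath R p) = 1 :=
  Finsupp.single_eq_same

theorem coeff_ofPath_of_ne {p q : QPath V} (h : q ≠ p) : coeff p (ofPath R q) = 0 := by
  classical
  rw [coeff_ofPath, if_neg h]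

theorem ofPath_comp (p q : QPath V) (h : q.head = p.tail) :
    ofPath R (p.comp q h) = ofPath R p * ofPath R q := by
  rw [ofPath_mul_ofPath, mulPath, dif_pos h]

theorem ofPath_mul_ofPath_of_ne (p q : QPath V) (h : q.head ≠ p.tail) :
    ofPath R p * ofPath R q = 0 := by
  rw [ofPath_mul_ofPath, mulPath, dif_neg h]

theorem eq_sum_coeff (x : PathAlgebra R V) :
    x = ∑ p ∈ Finsupp.support (M := R) x, coeff p x • ofPath R p := by
  have h := (pathBasis (R := R) (V := V)).linearCombination_repr x
  conv_lhs => rw [← h]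
  rw [Finsupp.linearCombination_apply, Finsupp.sum]
  simp only [pathBasis_apply]
  rfl

/-- Paths form a basis, so a span of paths is cut out by vanishing coefficients. Membership in `A`,
and the vanishing of arrow coefficients on `A²`, are read off in this way. -/
theorem mem_span_ofPath_iff (S : Set (QPath V)) (x : PathAlgebra R V) :
    x ∈ Submodule.span R (ofPath R '' S) ↔ ∀ p ∉ S, coeff p x = 0 := by
  constructor
  · intro hx p hp
    have : Submodule.span R (ofPath R '' S) ≤ LinearMap.ker (coeff (R := R) p) := by
      rw [Submodule.span_le]
      rintro _ ⟨q, hq, rfl⟩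
      exact coeff_ofPath_of_ne fun h => hp (h ▸ hq)
    exact this hx
  · intro h
    rw [eq_sum_coeff x]
    refine Submodule.sum_mem _ fun p hp => ?_
    by_cases hS : p ∈ S
    · exact Submodule.smul_mem _ _ (Submodule.subset_span ⟨p, hS, rfl⟩)
    · rw [h p hS, zero_smul]
      exact zero_mem _

theorem lengthSpan_eq (l : ℕ) :
    lengthSpan R V l = Submodule.span R (ofPath R '' {p | p.length = l}) := by
  rw [lengthSpan]
  congr 1
  ext x
  simp [eq_comm]

theorem arrowIdeal_eq :
    arrowIdeal R V = Submodule.span R (ofPath R '' {p | 1 ≤ p.length}) := by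
  simp only [arrowIdeal, lengthSpan_eq]
  simp only [← Submodule.span_iUnion, ← Set.image_iUnion]
  congr 2
  ext p
  simp

theorem ofPath_mem_arrowIdeal {p : QPath V} (h : 1 ≤ p.length) :
    ofPath R p ∈ arrowIdeal R V := by
  rw [arrowIdeal_eq]
  exact Submodule.subset_span ⟨p, h, rfl⟩

theorem mem_arrowIdeal_iff (x : PathAlgebra R V) :
    x ∈ arrowIdeal R V ↔ ∀ v, coeff (QPath.triv v) x = 0 := by
  rw [arrowIdeal_eq, mem_span_ofPath_iff]
  constructor
  · intro h v
    exact h _ (by simp)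
  · intro h p hp
    have hp' : p.length = 0 := by simpa using hp
    rw [QPath.eq_triv_of_length_eq_zero p hp']
    exact h _

theorem ofArrow_mem_arrowIdeal {u v : V} (a : u ⟶ v) :
    ofPath R (QPath.ofArrow a) ∈ arrowIdeal R V :=
  ofPath_mem_arrowIdeal le_rfl

theorem lengthSpan_le_arrowIdeal {l : ℕ} (h : 1 ≤ l) : lengthSpan R V l ≤ arrowIdeal R V :=
  le_iSup₂_of_le l h le_rfl

theorem fg_lengthSpan [Finite V] [∀ u v : V, Finite (u ⟶ v)] (l : ℕ) :
    (lengthSpan R V l).FG := by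
  rw [lengthSpan_eq]
  exact Submodule.fg_span ((QPath.finite_length_eq l).image _)

variable [Fintype V]

theorem span_mul_span_le {S T U : Set (QPath V)}
    (h : ∀ p ∈ S, ∀ q ∈ T, ∀ hpq : q.head = p.tail, p.comp q hpq ∈ U) :
    Submodule.span R (ofPath R '' S) * Submodule.span R (ofPath R '' T) ≤
      Submodule.span R (ofPath R '' U) := by
  rw [Submodule.span_mul_span, Submodule.span_le]
  rintro _ ⟨_, ⟨p, hp, rfl⟩, _, ⟨q, hq, rfl⟩, rfl⟩
  dsimp only
  by_cases hpq : q.head = p.tail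
  · rw [← ofPath_comp p q hpq]
    exact Submodule.subset_span ⟨_, h p hp q hq hpq, rfl⟩
  · rw [ofPath_mul_ofPath_of_ne p q hpq]
    exact zero_mem _

theorem mul_mem_arrowIdeal_left (x : PathAlgebra R V) {y : PathAlgebra R V}
    (hy : y ∈ arrowIdeal R V) : x * y ∈ arrowIdeal R V := by
  have hx : x ∈ Submodule.span R (ofPath R '' (Set.univ : Set (QPath V))) := by
    rw [mem_span_ofPath_iff]
    simp
  rw [arrowIdeal_eq] at hy ⊢
  refine span_mul_span_le (fun p _ q hq hpq => ?_) (Submodule.mul_mem_mul hx hy)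
  simp only [Set.mem_ofPred_eq, QPath.length_comp] at hq ⊢
  omega

theorem arrowIdeal_sq_le :
    arrowIdeal R V ^ 2 ≤ Submodule.span R (ofPath R '' {p | 2 ≤ p.length}) := by
  rw [pow_two, arrowIdeal_eq]
  refine span_mul_span_le fun p hp q hq hpq => ?_
  simp only [Set.mem_ofPred_eq, QPath.length_comp] at hp hq ⊢
  omega

theorem coeff_ofArrow_of_mem_sq {x : PathAlgebra R V} (hx : x ∈ arrowIdeal R V ^ 2)
    {u v : V} (a : u ⟶ v) : coeff (QPath.ofArrow a) x = 0 :=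
  (mem_span_ofPath_iff _ _).1 (arrowIdeal_sq_le hx) _ (by simp)

/-- Every path of length at least `m ≥ 1` lies in the `m`-th power of the arrow ideal. -/
theorem ofPath_mem_arrowIdeal_pow {m : ℕ} (hm : 1 ≤ m) (p : QPath V) (h : m ≤ p.length) :
    ofPath R p ∈ arrowIdeal R V ^ m := by
  -- The induction starts at 1 because the zeroth power is only `R · 1`.
  induction m, hm using Nat.le_induction generalizing p with
  | base =>
    rw [pow_one]
    exact ofPath_mem_arrowIdeal h
  | succ m hm ih =>
    obtain ⟨v, a, q, hq, e, hl⟩ := QPath.exists_eq_comp_ofArrow p (by omega)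
    rw [e, ofPath_comp, pow_succ]
    exact Submodule.mul_mem_mul (ih q (by omega)) (ofArrow_mem_arrowIdeal a)

end Coeff

/-! ### Algebra homomorphisms out of a path algebra. -/

section Lift

variable {R V : Type*} [CommRing R] [Quiver V]
variable {Γ : Type*} [Ring Γ] [Algebra R Γ]

/-- The product along a path of elements attached to the arrows. -/
def evalPath (e : V → Γ) (γ : ∀ {u v : V}, (u ⟶ v) → Γ) {u : V} :
    ∀ {v : V}, Quiver.Path u v → Γ
  | _, .nil => e u
  | _, .cons p a => γ a * evalPath e γ p

/-- The linear extension of `evalPath` to the path algebra. -/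
def evalLin (e : V → Γ) (γ : ∀ {u v : V}, (u ⟶ v) → Γ) : PathAlgebra R V →ₗ[R] Γ :=
  pathBasis.constr R fun p => evalPath e γ p.path

theorem evalLin_ofPath (e : V → Γ) (γ : ∀ {u v : V}, (u ⟶ v) → Γ) (p : QPath V) :
    evalLin e γ (ofPath R p) = evalPath e γ p.path := by
  rw [evalLin, ← pathBasis_apply, Module.Basis.constr_basis]

variable [Fintype V]
variable {e : V → Γ} (he : CompleteOrthogonalIdempotents e) {γ : ∀ {u v : V}, (u ⟶ v) → Γ}
  (hl : ∀ {u v : V} (a : u ⟶ v), e v * γ a = γ a)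

include he hl in
theorem mul_evalPath {u v : V} (p : Quiver.Path u v) :
    e v * evalPath e γ p = evalPath e γ p := by
  cases p with
  | nil => exact he.idem u
  | cons p a => rw [evalPath, ← mul_assoc, hl]

-- No condition on `γ a * e u` is needed: the trivial path at the tail contributes `e u` as the
-- rightmost factor.
include he in
theorem evalPath_mul {u v : V} (p : Quiver.Path u v) :
    evalPath e γ p * e u = evalPath e γ p := by
  induction p with
  | nil => exact he.idem u
  | cons p a ih => rw [evalPath, mul_assoc, ih]

include he hl in
theorem evalPath_comp {u v w : V} (p : Quiver.Path u v) (q : Quiver.Path v w) :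
    evalPath e γ (p.comp q) = evalPath e γ q * evalPath e γ p := by
  induction q with
  | nil => rw [Quiver.Path.comp_nil, evalPath, mul_evalPath he hl]
  | cons q a ih => rw [Quiver.Path.comp_cons, evalPath, evalPath, ih, mul_assoc]

/-- The algebra homomorphism out of a path algebra given by a complete orthogonal set of idempotents
and an element of `e_v Γ` for every arrow `u ⟶ v`. -/
def lift : PathAlgebra R V →ₐ[R] Γ :=
  AlgHom.ofLinearMap (evalLin e γ)
    (by
      rw [one_def, map_sum, ← he.complete]
      exact Finset.sum_congr rfl fun v _ => evalLin_ofPath e γ _)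
    (by
      intro x y
      induction x using induction_path with
      | h0 => simp only [zero_mul, map_zero]
      | ha x x' hx hx' => simp only [add_mul, map_add, hx, hx']
      | hs r x hx => simp only [smul_mul_assoc, map_smul, hx]
      | hp p =>
        induction y using induction_path with
        | h0 => simp only [mul_zero, map_zero]
        | ha y y' hy hy' => simp only [mul_add, map_add, hy, hy']
        | hs r y hy => simp only [mul_smul_comm, map_smul, hy]
        | hp q =>
          obtain ⟨a, b, p⟩ := p
          obtain ⟨c, d, q⟩ := q
          by_cases h : d = a
          · subst h
            rw [← ofPath_comp _ _ rfl]
            simp only [evalLin_ofPath, QPath.comp]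
            rw [← evalPath_comp he hl]
            rfl
          · rw [ofPath_mul_ofPath_of_ne _ _ h, map_zero, evalLin_ofPath, evalLin_ofPath]
            dsimp only
            -- The paths do not compose; inserting the idempotents at the two ends that fail to meet
            -- makes the product vanish by orthogonality.
            rw [← evalPath_mul he p, ← mul_evalPath he hl q, mul_assoc, ← mul_assoc (e a),
              he.ortho (Ne.symm h), zero_mul, mul_zero])

theorem lift_ofPath (p : QPath V) :
    lift (R := R) he hl (ofPath R p) = evalPath e γ p.path :=
  evalLin_ofPath e γ p

@[simp] theorem lift_triv (v : V) :
    lift (R := R) he hl (ofPath R (QPath.triv v)) = e v :=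
  lift_ofPath he hl _

theorem lift_ofArrow {u v : V} (a : u ⟶ v) (hr : γ a * e u = γ a) :
    lift (R := R) he hl (ofPath R (QPath.ofArrow a)) = γ a :=
  (lift_ofPath he hl _).trans hr

end Lift

end PathAlgebra

/-! ### Nakayama's lemma and the left ideals `Γ e`. -/

section Noncommutative

variable {Γ M : Type*} [Ring Γ] [AddCommGroup M] [Module Γ M]

/-- Nakayama's lemma over a noncommutative ring. -/
theorem Submodule.eq_top_of_sup_jacobson_smul_eq_top [Module.Finite Γ M] {N : Submodule Γ M}
    (h : N ⊔ Ring.jacobson Γ • (⊤ : Submodule Γ M) = ⊤) : N = ⊤ := by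
  by_contra hN
  obtain ⟨C, hC, hNC⟩ := (eq_top_or_exists_le_coatom N).resolve_left hN
  refine hC.1 (top_le_iff.1 (h ▸ sup_le hNC ?_))
  exact (Ring.jacobson_smul_top_le Γ M).trans (sInf_le hC)

theorem mem_mulRightIdeal {N : Ideal Γ} {e x : Γ} :
    x ∈ mulRightIdeal N e ↔ ∃ y ∈ N, y * e = x := by
  simp [mulRightIdeal, Submodule.mem_map]

theorem mem_mulRightIdeal_top {e x : Γ} (he : IsIdempotentElem e) :
    x ∈ mulRightIdeal ⊤ e ↔ x * e = x := by
  rw [mem_mulRightIdeal]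
  constructor
  · rintro ⟨y, -, rfl⟩
    rw [mul_assoc, he.eq]
  · intro h
    exact ⟨x, trivial, h⟩

theorem mem_mulRightIdeal_jacobson {e x : Γ} (he : IsIdempotentElem e) :
    x ∈ mulRightIdeal (Ring.jacobson Γ) e ↔ x ∈ Ring.jacobson Γ ∧ x * e = x := by
  rw [mem_mulRightIdeal]
  constructor
  · rintro ⟨y, hy, rfl⟩
    exact ⟨Ideal.mul_mem_right _ _ hy, by rw [mul_assoc, he.eq]⟩
  · rintro ⟨h, h'⟩
    exact ⟨x, h, h'⟩

/-- From `e = e * e` one gets `Γ e ⊆ J (Γ e)`, and Nakayama applies to this cyclic module. -/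
theorem IsIdempotentElem.eq_zero_of_mem_jacobson {e : Γ} (he : IsIdempotentElem e)
    (h : e ∈ Ring.jacobson Γ) : e = 0 := by
  by_contra hne
  have fg : (Submodule.span Γ {e} : Ideal Γ).FG := Submodule.fg_span (Set.finite_singleton e)
  have := Submodule.FG.eq_bot_of_le_jacobson_smul fg (by
    rw [Submodule.span_singleton_le_iff_mem]
    have := Submodule.smul_mem_smul h (Submodule.mem_span_singleton_self (R := Γ) e)
    have he' : e • e = e := he.eq
    rwa [he'] at this)
  exact hne (Submodule.span_singleton_eq_bot.1 this)

theorem IsLocalIdempotent.ne_zero {e : Γ} (he : IsLocalIdempotent e) : e ≠ 0 := by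
  rintro rfl
  have h1 : ∀ N : Ideal Γ, mulRightIdeal N 0 = ⊥ := fun N => by
    rw [eq_bot_iff]
    intro x hx
    obtain ⟨y, -, rfl⟩ := mem_mulRightIdeal.1 hx
    simp
  have h := (he.2 ⊥).2 (h1 _).symm
  rw [h1] at h
  exact h.1.ne rfl

theorem IsLocalIdempotent.not_mem_jacobson {e : Γ} (he : IsLocalIdempotent e) :
    e ∉ Ring.jacobson Γ :=
  fun h => he.ne_zero (he.1.eq_zero_of_mem_jacobson h)

theorem mulRightIdeal_projective {e : Γ} (he : IsIdempotentElem e) :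
    Module.Projective Γ (mulRightIdeal (⊤ : Ideal Γ) e) := by
  refine Module.Projective.of_split (mulRightIdeal (⊤ : Ideal Γ) e).subtype
    ((LinearMap.toSpanSingleton Γ Γ e).codRestrict _ fun x => mem_mulRightIdeal.2 ⟨x, trivial, rfl⟩)
    ?_
  ext x
  exact (mem_mulRightIdeal_top he).1 x.2

instance mulRightIdeal_finite {e : Γ} :
    Module.Finite Γ (mulRightIdeal (⊤ : Ideal Γ) e) :=
  Module.Finite.iff_fg.2 ((Module.Finite.fg_top (R := Γ) (M := Γ)).map _)

end Noncommutative

/-! ### The radical of a finite algebra over a local ring. -/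

section Algebra

variable {R Γ : Type*} [CommRing R] [Ring Γ] [Algebra R Γ]

/-- If a maximal left ideal `C` missed `B`, then `1 = b' + c` with `b' ∈ B` and `c ∈ C`. Multiplying
repeatedly by `b'` gives elements of every `B ^ k` congruent to 1 modulo `C`; for `k = m` such an
element lies in `J ⊆ C`, which is absurd. -/
theorem le_jacobson_of_pow_le {B : Submodule R Γ} (hB : ∀ x, ∀ b ∈ B, x * b ∈ B) {m : ℕ}
    (hm : B ^ m ≤ (Ring.jacobson Γ).restrictScalars R) :
    B ≤ (Ring.jacobson Γ).restrictScalars R := by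
  intro b hb
  rw [Submodule.restrictScalars_mem, Ring.jacobson, Module.jacobson, Submodule.mem_sInf]
  intro C hC
  by_contra hbC
  let B' : Ideal Γ :=
    { B with smul_mem' := fun x b hb => hB x b hb }
  have htop : B' ⊔ C = ⊤ := by
    refine hC.2 _ (lt_of_le_of_ne le_sup_right fun h => hbC ?_)
    rw [h]
    exact Submodule.mem_sup_left hb
  obtain ⟨b', hb', c, hc, hbc⟩ := Submodule.mem_sup.1 (htop ▸ trivial : (1 : Γ) ∈ B' ⊔ C)
  have key : ∀ k : ℕ, ∃ y ∈ B ^ k, 1 - y ∈ C := by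
    intro k
    induction k with
    | zero => exact ⟨1, Submodule.one_le.1 le_rfl, by simp⟩
    | succ k ih =>
      obtain ⟨y, hy, h⟩ := ih
      refine ⟨y * b', by rw [pow_succ]; exact Submodule.mul_mem_mul hy hb', ?_⟩
      have : 1 - y * b' = (1 - y) + y * c := by rw [eq_sub_of_add_eq' hbc]; noncomm_ring
      rw [this]
      exact C.add_mem h (Ideal.mul_mem_left C y hc)
  obtain ⟨y, hy, h⟩ := key m
  have : (1 : Γ) ∈ C := by
    have := C.add_mem h ((sInf_le hC : Module.jacobson Γ Γ ≤ C) (hm hy))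
    simpa using this
  exact hC.1 ((Ideal.eq_top_iff_one C).2 this)

variable (Γ) in
/-- The two-sided ideal `𝔞 Γ` generated by an ideal `𝔞` of the base ring. -/
def smulTopIdeal (𝔞 : Ideal R) : Ideal Γ :=
  { 𝔞 • (⊤ : Submodule R Γ) with
    smul_mem' := fun x b hb => by
      have : Submodule.map (LinearMap.mulLeft R x) (𝔞 • (⊤ : Submodule R Γ)) ≤ 𝔞 • ⊤ := by
        rw [Submodule.map_smul'']
        exact Submodule.smul_mono le_rfl le_top
      exact this ⟨b, hb, rfl⟩ }

instance (𝔞 : Ideal R) : (smulTopIdeal Γ 𝔞).IsTwoSided where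
  mul_mem_of_left {b} x hb := by
    have : Submodule.map (LinearMap.mulRight R x) (𝔞 • (⊤ : Submodule R Γ)) ≤ 𝔞 • ⊤ := by
      rw [Submodule.map_smul'']
      exact Submodule.smul_mono le_rfl le_top
    exact this ⟨_, hb, rfl⟩

variable [IsLocalRing R]

open IsLocalRing

/-- A maximal left ideal `C` not containing `𝔪Γ` would satisfy `C + 𝔪Γ = Γ`, hence `C = Γ` by
Nakayama over `R`. -/
theorem smul_top_le_jacobson [Module.Finite R Γ] :
    maximalIdeal R • (⊤ : Submodule R Γ) ≤ (Ring.jacobson Γ).restrictScalars R := by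
  intro b hb
  rw [Submodule.restrictScalars_mem, Ring.jacobson, Module.jacobson, Submodule.mem_sInf]
  intro C hC
  by_contra hbC
  have htop : C ⊔ smulTopIdeal Γ (maximalIdeal R) = ⊤ := by
    refine hC.2 _ (lt_of_le_of_ne le_sup_left fun h => hbC ?_)
    rw [h]
    exact Submodule.mem_sup_right hb
  refine hC.1 (top_le_iff.1 ?_)
  have h : (⊤ : Submodule R Γ) ≤ C.restrictScalars R :=
    Submodule.le_of_le_smul_of_le_jacobson_bot Module.Finite.fg_top
      (IsLocalRing.maximalIdeal_le_jacobson ⊥) (fun x _ => by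
        have hx : x ∈ C ⊔ smulTopIdeal Γ (maximalIdeal R) := htop ▸ trivial
        obtain ⟨c, hc, d, hd, rfl⟩ := Submodule.mem_sup.1 hx
        exact Submodule.add_mem_sup hc hd)
  exact fun x _ => h (trivial : x ∈ (⊤ : Submodule R Γ))

theorem smul_mem_jacobson [Module.Finite R Γ] {r : R} (hr : r ∈ maximalIdeal R) (x : Γ) :
    r • x ∈ Ring.jacobson Γ :=
  smul_top_le_jacobson (R := R) (Submodule.smul_mem_smul hr trivial)

theorem mem_maximalIdeal_of_smul_mem_jacobson {r : R} {e : Γ} (he : e ∉ Ring.jacobson Γ)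
    (h : r • e ∈ Ring.jacobson Γ) : r ∈ maximalIdeal R := by
  by_contra hr
  rw [IsLocalRing.mem_maximalIdeal, mem_nonunits_iff, not_not] at hr
  obtain ⟨s, hs⟩ := hr.exists_left_inv
  refine he ?_
  have := ((Ring.jacobson Γ).restrictScalars R).smul_mem s h
  rwa [smul_smul, hs, one_smul] at this

/-- `Γ/𝔪Γ` is finite-dimensional over `k`, hence artinian with nilpotent radical, and the image of
`J` lies in that radical. -/
theorem exists_jacobson_pow_le_smul_top [Module.Finite R Γ] :
    ∃ n, 0 < n ∧ ((Ring.jacobson Γ).restrictScalars R) ^ n ≤ maximalIdeal R • (⊤ : Submodule R Γ) := by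
  let I := smulTopIdeal Γ (maximalIdeal R)
  have h0 : IsArtinian (R ⧸ maximalIdeal R) (Γ ⧸ maximalIdeal R • (⊤ : Submodule R Γ)) := by
    let := Ideal.Quotient.field (maximalIdeal R)
    have : Module.Finite (R ⧸ maximalIdeal R) (Γ ⧸ maximalIdeal R • (⊤ : Submodule R Γ)) :=
      Module.Finite.of_restrictScalars_finite R _ _
    infer_instance
  have h1 : IsArtinian R (Γ ⧸ maximalIdeal R • (⊤ : Submodule R Γ)) :=
    isArtinian_of_surjective_algebraMap (R := R ⧸ maximalIdeal R) Ideal.Quotient.mk_surjective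
  have h2 : IsArtinian R (Γ ⧸ I) :=
    (LinearEquiv.isArtinian_iff (Submodule.Quotient.restrictScalarsEquiv R I)).1 h1
  have h3 : IsArtinianRing (Γ ⧸ I) := isArtinian_of_tower R h2
  obtain ⟨n, hn⟩ := IsSemiprimaryRing.isNilpotent (R := Γ ⧸ I)
  -- One more factor guarantees a positive exponent, as the lower bound condition requires.
  refine ⟨n + 1, n.succ_pos, ?_⟩
  have key : ∀ k, ∀ x ∈ ((Ring.jacobson Γ).restrictScalars R) ^ k,
      Ideal.Quotient.mk I x ∈ Ring.jacobson (Γ ⧸ I) ^ k := by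
    intro k
    induction k with
    | zero =>
      intro x _
      rw [Submodule.pow_zero, Submodule.one_eq_span]
      exact Submodule.mem_span_singleton.2 ⟨_, mul_one _⟩
    | succ k ih =>
      intro x hx
      rw [pow_succ] at hx
      rw [Submodule.pow_succ]
      induction hx using Submodule.mul_induction_on' with
      | mem_mul_mem y hy z hz =>
        rw [map_mul]
        exact Submodule.smul_mem_smul (ih y hy) (Ring.le_comap_jacobson (Ideal.Quotient.mk I) hz)
      | add y _ z _ hy hz =>
        rw [map_add]
        exact add_mem hy hz
  intro x hx
  have := key _ x hx
  rw [Submodule.pow_succ, hn, Submodule.zero_eq_bot, Submodule.bot_mul] at this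
  exact Ideal.Quotient.eq_zero_iff_mem.1 this

end Algebra

/-! ### Direct sums of the modules `Γ e_i` and projective covers. -/

section SumOfPrincipal

variable {Γ : Type*} [Ring Γ]

/-- The generator `e` of the left ideal `Γ e`. -/
def mulRightIdealGen (e : Γ) : mulRightIdeal (⊤ : Ideal Γ) e :=
  ⟨e, mem_mulRightIdeal.2 ⟨1, trivial, one_mul e⟩⟩

variable {ι : Type*} [Fintype ι] [DecidableEq ι] {e : ι → Γ} (he : ∀ i, IsIdempotentElem (e i))

include he in
theorem directSum_eq_sum_smul (y : DirectSum ι fun i => mulRightIdeal (⊤ : Ideal Γ) (e i)) :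
    y = ∑ i, (y i : Γ) •
      DirectSum.lof Γ ι (fun i => mulRightIdeal (⊤ : Ideal Γ) (e i)) i (mulRightIdealGen (e i)) := by
  conv_lhs => rw [← DirectSum.sum_univ_of y]
  refine Finset.sum_congr rfl fun i _ => ?_
  rw [← map_smul, DirectSum.lof_eq_of]
  congr 1
  exact Subtype.ext ((mem_mulRightIdeal_top (he i)).1 (y i).2).symm

include he in
theorem mem_jacobson_smul_top {y : DirectSum ι fun i => mulRightIdeal (⊤ : Ideal Γ) (e i)}
    (h : ∀ i, (y i : Γ) ∈ Ring.jacobson Γ) :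
    y ∈ Ring.jacobson Γ •
      (⊤ : Submodule Γ (DirectSum ι fun i => mulRightIdeal (⊤ : Ideal Γ) (e i))) := by
  rw [directSum_eq_sum_smul he y]
  exact Submodule.sum_mem _ fun i _ => Submodule.smul_mem_smul (h i) trivial

include he in
theorem coe_map_directSum_eq_sum {N : Ideal Γ}
    (π : (DirectSum ι fun i => mulRightIdeal (⊤ : Ideal Γ) (e i)) →ₗ[Γ] N)
    (y : DirectSum ι fun i => mulRightIdeal (⊤ : Ideal Γ) (e i)) :
    (π y : Γ) = ∑ i, (y i : Γ) * (π (DirectSum.lof Γ ι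
      (fun i => mulRightIdeal (⊤ : Ideal Γ) (e i)) i (mulRightIdealGen (e i))) : Γ) := by
  conv_lhs => rw [directSum_eq_sum_smul he y]
  simp only [map_sum, map_smul, AddSubmonoidClass.coe_finsetSum, SetLike.val_smul, smul_eq_mul]

end SumOfPrincipal

/-- A criterion for the Gabriel quiver in terms of generators `γ_a` of `J e_u` which are minimal
modulo `J`. -/
theorem isGabrielQuiver_of_generators {V : Type*} [Quiver V] [Fintype V]
    [∀ u v : V, Finite (u ⟶ v)] {Γ : Type*} [Ring Γ] {e : V → Γ}
    (he : CompleteOrthogonalIdempotents e) (hloc : ∀ v, IsLocalIdempotent (e v))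
    (γ : ∀ {u v : V}, (u ⟶ v) → Γ) (hγ : ∀ {u v : V} (a : u ⟶ v), γ a ∈ Ring.jacobson Γ)
    (hl : ∀ {u v : V} (a : u ⟶ v), e v * γ a = γ a)
    (hr : ∀ {u v : V} (a : u ⟶ v), γ a * e u = γ a)
    (hgen : ∀ (u : V) [Fintype (Σ v : V, (u ⟶ v))], ∀ x ∈ Ring.jacobson Γ,
      ∃ c : (Σ v : V, (u ⟶ v)) → Γ, x * e u = ∑ a, c a * γ a.2)
    (hmin : ∀ (u : V) [Fintype (Σ v : V, (u ⟶ v))] (y : (Σ v : V, (u ⟶ v)) → Γ),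
      (∀ a, y a * e a.1 = y a) → ∑ a, y a * γ a.2 = 0 → ∀ a, y a ∈ Ring.jacobson Γ) :
    IsGabrielQuiver V Γ := by
  classical
  refine ⟨e, he, hloc, fun u => ?_⟩
  have := Fintype.ofFinite (Σ v : V, (u ⟶ v))
  have he' : ∀ a : Σ v : V, (u ⟶ v), IsIdempotentElem (e a.1) := fun a => he.idem a.1
  let f : ∀ a : Σ v : V, (u ⟶ v), mulRightIdeal (⊤ : Ideal Γ) (e a.1) →ₗ[Γ]
      mulRightIdeal (Ring.jacobson Γ) (e u) :=
    fun a => ((LinearMap.toSpanSingleton Γ Γ (γ a.2)).comp (Submodule.subtype _)).codRestrict _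
      fun x => (mem_mulRightIdeal_jacobson (he.idem u)).2 ⟨Ideal.mul_mem_left _ _ (hγ a.2), by
        rw [LinearMap.comp_apply, LinearMap.toSpanSingleton_apply, smul_eq_mul, mul_assoc, hr]⟩
  have hf : ∀ a x, (f a x : Γ) = x * γ a.2 := fun _ _ => rfl
  let π := DirectSum.toModule Γ _ _ f
  have hπ : ∀ y, (π y : Γ) = ∑ a, (y a : Γ) * γ a.2 := by
    intro y
    rw [coe_map_directSum_eq_sum he' π y]
    refine Finset.sum_congr rfl fun a _ => ?_
    rw [DirectSum.toModule_lof, hf]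
    exact congrArg _ (hl a.2)
  have hproj : ∀ a : Σ v : V, (u ⟶ v), Module.Projective Γ (mulRightIdeal (⊤ : Ideal Γ) (e a.1)) :=
    fun a => mulRightIdeal_projective (he' a)
  refine ⟨π, inferInstance, ?_, fun N hN => ?_⟩
  · rintro ⟨x, hx⟩
    obtain ⟨hxJ, hxu⟩ := (mem_mulRightIdeal_jacobson (he.idem u)).1 hx
    obtain ⟨c, hc⟩ := hgen u x hxJ
    refine ⟨∑ a, c a • DirectSum.lof Γ _ _ a (mulRightIdealGen _), Subtype.ext ?_⟩
    rw [map_sum, AddSubmonoidClass.coe_finsetSum]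
    refine Eq.trans ?_ (hc.symm.trans hxu)
    refine Finset.sum_congr rfl fun a _ => ?_
    rw [map_smul, DirectSum.toModule_lof, SetLike.val_smul, hf, smul_eq_mul]
    exact congrArg _ (hl a.2)
  -- Minimality puts the kernel of `π` inside `J` times the direct sum, so Nakayama makes it
  -- superfluous.
  · refine Submodule.eq_top_of_sup_jacobson_smul_eq_top
      (top_le_iff.1 (hN.ge.trans (sup_le_sup_left (fun y hy => ?_) _)))
    refine mem_jacobson_smul_top he' (hmin u (fun a => (y a : Γ))
      (fun a => (mem_mulRightIdeal_top (he' a)).1 (y a).2) ?_)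
    rw [← hπ, LinearMap.mem_ker.1 hy]
    rfl

/-- A surjective ring homomorphism whose kernel is the radical induces an isomorphism. -/
def quotientJacobsonEquiv {Γ S : Type*} [Ring Γ] [Ring S] (f : Γ →+* S) (hf : Surjective f)
    (h : ∀ x, x ∈ Ring.jacobson Γ ↔ f x = 0) : (Γ ⧸ Ring.jacobson Γ) ≃+* S :=
  RingEquiv.ofBijective (Ideal.Quotient.lift (Ring.jacobson Γ) f fun x hx => (h x).1 hx)
    ⟨by
      rw [injective_iff_map_eq_zero]
      intro x hx
      obtain ⟨y, rfl⟩ := Ideal.Quotient.mk_surjective x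
      exact Ideal.Quotient.eq_zero_iff_mem.2 ((h y).2 hx),
    fun y => by
      obtain ⟨x, rfl⟩ := hf y
      exact ⟨Ideal.Quotient.mk _ x, rfl⟩⟩

/-! ### A criterion for local idempotents. -/

section LocalIdempotent

open IsLocalRing

variable {R Γ : Type*} [CommRing R] [IsLocalRing R] [Ring Γ] [Algebra R Γ] [Module.Finite R Γ]

/-- An idempotent `e` outside the radical such that `Γ e / J e` is generated by `e` over the base
ring is local. -/
theorem isLocalIdempotent_of_forall_exists {e : Γ} (he : IsIdempotentElem e)
    (hJ : e ∉ Ring.jacobson Γ) (h : ∀ x : Γ, ∃ r : R, x * e - r • e ∈ Ring.jacobson Γ) :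
    IsLocalIdempotent e := by
  have hle : mulRightIdeal (Ring.jacobson Γ) e ≤ mulRightIdeal ⊤ e := Submodule.map_mono le_top
  have htop : ∀ N : Ideal Γ, e ∈ N → mulRightIdeal ⊤ e ≤ N := by
    intro N hN x hx
    obtain ⟨y, -, rfl⟩ := mem_mulRightIdeal.1 hx
    exact N.smul_mem y hN
  have hcov : mulRightIdeal (Ring.jacobson Γ) e ⋖ mulRightIdeal ⊤ e := by
    refine ⟨lt_of_le_of_ne hle fun h' => hJ ?_, fun N hN hN' => ?_⟩
    · have : e ∈ mulRightIdeal (Ring.jacobson Γ) e := by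
        rw [h']
        exact (mem_mulRightIdeal_top he).2 he.eq
      exact ((mem_mulRightIdeal_jacobson he).1 this).1
    · obtain ⟨x, hx, hxJ⟩ := SetLike.exists_of_lt hN
      have hxe := (mem_mulRightIdeal_top he).1 (hN'.le hx)
      obtain ⟨r, hr⟩ := h x
      rw [hxe] at hr
      refine hN'.not_ge (htop N ?_)
      -- A nonunit `r` lies in `𝔪`, so `r • e ∈ J`, and then `x` itself would lie in `J e`.
      have hunit : IsUnit r := by
        by_contra hnu
        refine hxJ ((mem_mulRightIdeal_jacobson he).2 ⟨?_, hxe⟩)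
        have := add_mem hr (smul_mem_jacobson (R := R) (show r ∈ maximalIdeal R from hnu) e)
        simpa using this
      obtain ⟨s, hs⟩ := hunit.exists_left_inv
      have h1 : s • x - e ∈ mulRightIdeal (Ring.jacobson Γ) e := by
        refine (mem_mulRightIdeal_jacobson he).2 ⟨?_, by
          rw [sub_mul, smul_mul_assoc, hxe, he.eq]⟩
        have := ((Ring.jacobson Γ).restrictScalars R).smul_mem s hr
        rwa [smul_sub, smul_smul, hs, one_smul] at this
      have h2 := sub_mem ((N.restrictScalars R).smul_mem s hx) (hN.le h1)
      simpa using h2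
  refine ⟨he, fun N => ⟨fun hN => ?_, fun hN => hN ▸ hcov⟩⟩
  -- Otherwise `N + J e = Γ e`, so `(1 - j) e ∈ N` for some `j ∈ J`. Nakayama for the left ideal of
  -- all `x` with `x e ∈ N` then forces `e ∈ N`.
  have hJN : mulRightIdeal (Ring.jacobson Γ) e ≤ N := by
    rcases hN.eq_or_eq (c := N ⊔ mulRightIdeal (Ring.jacobson Γ) e) le_sup_left
      (sup_le hN.le hle) with h1 | h1
    · exact sup_eq_left.1 h1
    · exfalso
      have heN : e ∈ N ⊔ mulRightIdeal (Ring.jacobson Γ) e :=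
        h1 ▸ (mem_mulRightIdeal_top he).2 he.eq
      obtain ⟨n, hn, j', hj', hnj⟩ := Submodule.mem_sup.1 heN
      obtain ⟨j, hj, rfl⟩ := mem_mulRightIdeal.1 hj'
      have hC : Submodule.comap (LinearMap.toSpanSingleton Γ Γ e) N = ⊤ := by
        refine Submodule.eq_top_of_sup_jacobson_smul_eq_top ?_
        rw [Ideal.eq_top_iff_one]
        have h2 : (1 - j) ∈ Submodule.comap (LinearMap.toSpanSingleton Γ Γ e) N := by
          rw [Submodule.mem_comap, LinearMap.toSpanSingleton_apply, smul_eq_mul, sub_mul, one_mul]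
          rwa [← eq_sub_of_add_eq hnj]
        have h3 := Submodule.smul_mem_smul hj (Submodule.mem_top (R := Γ) (x := (1 : Γ)))
        have h4 : j • (1 : Γ) = j := mul_one j
        rw [h4] at h3
        have := Submodule.add_mem_sup h2 h3
        simpa using this
      have : (1 : Γ) ∈ Submodule.comap (LinearMap.toSpanSingleton Γ Γ e) N := hC ▸ trivial
      rw [Submodule.mem_comap, LinearMap.toSpanSingleton_apply, one_smul] at this
      exact hN.lt.not_ge (htop N this)
  rcases hcov.eq_or_eq hJN hN.le with h1 | h1
  · exact h1
  · exact absurd h1 hN.ne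

end LocalIdempotent

namespace PathAlgebra

/-! ### Vertices and arrows as elements of the path algebra. -/

section Elements

variable {R V : Type*} [CommRing R] [Quiver V]

theorem ofPath_mul_triv (p : QPath V) :
    ofPath R p * ofPath R (QPath.triv p.tail) = ofPath R p := by
  rw [← ofPath_comp p (QPath.triv p.tail) rfl]
  exact congrArg _ (QPath.comp_triv _ _ rfl)

theorem triv_mul_ofPath (p : QPath V) :
    ofPath R (QPath.triv p.head) * ofPath R p = ofPath R p := by
  rw [← ofPath_comp (QPath.triv p.head) p rfl]
  exact congrArg _ (QPath.triv_comp _ _ rfl)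

theorem ofArrow_mul_triv {u v : V} (a : u ⟶ v) :
    ofPath R (QPath.ofArrow a) * ofPath R (QPath.triv u) = ofPath R (QPath.ofArrow a) :=
  ofPath_mul_triv (QPath.ofArrow a)

theorem triv_mul_ofArrow {u v : V} (a : u ⟶ v) :
    ofPath R (QPath.triv v) * ofPath R (QPath.ofArrow a) = ofPath R (QPath.ofArrow a) :=
  triv_mul_ofPath (QPath.ofArrow a)

theorem smul_mem_maxIdealSpan [IsLocalRing R] {r : R} (hr : r ∈ IsLocalRing.maximalIdeal R)
    (x : PathAlgebra R V) : r • x ∈ maxIdealSpan R V := fun p => by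
  rw [map_smul, smul_eq_mul]
  exact Ideal.mul_mem_right _ _ hr

/-- In the form `𝔪 • ⊤`, the submodule `𝔪Q` can be transported along linear maps. -/
theorem maxIdealSpan_eq [IsLocalRing R] :
    maxIdealSpan R V = IsLocalRing.maximalIdeal R • (⊤ : Submodule R (PathAlgebra R V)) := by
  refine le_antisymm (fun x hx => ?_) (Submodule.smul_le.2 fun r hr x _ =>
    smul_mem_maxIdealSpan hr x)
  rw [eq_sum_coeff x]
  exact Submodule.sum_mem _ fun p _ => Submodule.smul_mem_smul (hx p) trivial

variable [Fintype V]

theorem completeOrthogonalIdempotents_triv :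
    CompleteOrthogonalIdempotents fun v : V => ofPath R (QPath.triv v) := by
  rw [CompleteOrthogonalIdempotents.iff_ortho_complete]
  refine ⟨fun u v h => ofPath_mul_ofPath_of_ne _ _ (Ne.symm h), rfl⟩

theorem sub_sum_triv_mem_arrowIdeal (x : PathAlgebra R V) :
    x - ∑ v, coeff (QPath.triv v) x • ofPath R (QPath.triv v) ∈ arrowIdeal R V := by
  classical
  rw [mem_arrowIdeal_iff]
  intro v
  rw [map_sub, map_sum, Finset.sum_eq_single v]
  · rw [map_smul, coeff_ofPath_self, smul_eq_mul, mul_one, sub_self]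
  · intro w _ hw
    rw [map_smul, coeff_ofPath_of_ne, smul_zero]
    exact fun h => hw (congrArg QPath.tail h)
  · simp

theorem coeff_mul_triv (p : QPath V) (x : PathAlgebra R V) :
    coeff p (x * ofPath R (QPath.triv p.tail)) = coeff p x := by
  induction x using induction_path with
  | h0 => simp
  | ha x y hx hy => rw [add_mul, map_add, map_add, hx, hy]
  | hs r x hx => rw [smul_mul_assoc, map_smul, map_smul, hx]
  | hp r =>
    by_cases h : p.tail = r.tail
    · rw [h, ofPath_mul_triv]
    · rw [ofPath_mul_ofPath_of_ne r (QPath.triv p.tail) h, map_zero, coeff_ofPath_of_ne]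
      rintro rfl
      exact h rfl

/-- The coefficient of an arrow in a sum of multiples of the arrows with a given tail. -/
theorem coeff_ofArrow_sum {u : V} [Fintype (Σ v : V, (u ⟶ v))]
    (c : (Σ v : V, (u ⟶ v)) → PathAlgebra R V) (b : Σ v : V, (u ⟶ v)) :
    coeff (QPath.ofArrow b.2) (∑ a, c a * ofPath R (QPath.ofArrow a.2)) =
      coeff (QPath.triv b.1) (c b) := by
  -- By length, a product of a path `p` with the arrow `a` equals the arrow `b` only if `p` is
  -- trivial and `a = b`.
  have key : ∀ (a : Σ v : V, (u ⟶ v)) (x : PathAlgebra R V),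
      (a = b → coeff (QPath.ofArrow b.2) (x * ofPath R (QPath.ofArrow a.2)) =
        coeff (QPath.triv b.1) x) ∧
      (a ≠ b → coeff (QPath.ofArrow b.2) (x * ofPath R (QPath.ofArrow a.2)) = 0) := by
    intro a x
    induction x using induction_path with
    | h0 => simp
    | ha x y hx hy =>
      simp only [add_mul, map_add]
      exact ⟨fun h => by rw [hx.1 h, hy.1 h], fun h => by rw [hx.2 h, hy.2 h, add_zero]⟩
    | hs r x hx =>
      simp only [smul_mul_assoc, map_smul]
      exact ⟨fun h => by rw [hx.1 h], fun h => by rw [hx.2 h, smul_zero]⟩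
    | hp p =>
      by_cases h : (QPath.ofArrow a.2).head = p.tail
      · rw [← ofPath_comp p _ h]
        by_cases h0 : p.length = 0
        · obtain ⟨w, rfl⟩ : ∃ w, p = QPath.triv w := ⟨_, QPath.eq_triv_of_length_eq_zero p h0⟩
          rw [QPath.triv_comp _ w h]
          obtain rfl : a.1 = w := h
          refine ⟨?_, fun hab => coeff_ofPath_of_ne fun h' => hab ?_⟩
          · rintro rfl
            rw [coeff_ofPath_self, coeff_ofPath_self]
          · have := @QPath.ofArrow_injective V _ ⟨u, a⟩ ⟨u, b⟩ h'
            exact eq_of_heq (Sigma.mk.inj this).2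
        · have hne : p.comp _ h ≠ QPath.ofArrow b.2 := fun h' => h0 (by
            have := congrArg QPath.length h'
            rw [QPath.length_comp, QPath.length_ofArrow, QPath.length_ofArrow] at this
            omega)
          have hne' : p ≠ QPath.triv b.1 := fun h' => h0 (by rw [h', QPath.length_triv])
          rw [coeff_ofPath_of_ne hne, coeff_ofPath_of_ne hne']
          simp
      · rw [ofPath_mul_ofPath_of_ne p _ h, map_zero]
        refine ⟨?_, fun _ => rfl⟩
        rintro rfl
        refine (coeff_ofPath_of_ne ?_).symm
        rintro rfl
        exact h rfl
  rw [map_sum, Finset.sum_eq_single b]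
  · exact (key b (c b)).1 rfl
  · intro a _ hab
    exact (key a (c a)).2 hab
  · simp

/-- Elements of the arrow ideal supported on paths with tail `u` are combinations of the arrows with
tail `u`. -/
theorem exists_mul_triv_eq_sum (u : V) [Fintype (Σ v : V, (u ⟶ v))] {x : PathAlgebra R V}
    (hx : x ∈ arrowIdeal R V) : ∃ c : (Σ v : V, (u ⟶ v)) → PathAlgebra R V,
      x * ofPath R (QPath.triv u) = ∑ a, c a * ofPath R (QPath.ofArrow a.2) := by
  classical
  rw [arrowIdeal_eq] at hx
  induction hx using Submodule.span_induction with
  | zero => exact ⟨0, by simp⟩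
  | add x y _ _ hx hy =>
    obtain ⟨c, hc⟩ := hx
    obtain ⟨d, hd⟩ := hy
    exact ⟨c + d, by simp only [Pi.add_apply, add_mul, Finset.sum_add_distrib, hc, hd]⟩
  | smul r x _ hx =>
    obtain ⟨c, hc⟩ := hx
    exact ⟨r • c, by simp only [Pi.smul_apply, smul_mul_assoc, ← Finset.smul_sum, hc]⟩
  | mem x h =>
    obtain ⟨p, hp, rfl⟩ := h
    by_cases hu : u = p.tail
    · subst hu
      obtain ⟨v, a, q, hq, h, -⟩ := QPath.exists_eq_comp_ofArrow p hp
      refine ⟨Pi.single ⟨v, a⟩ (ofPath R q), ?_⟩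
      rw [Finset.sum_eq_single ⟨v, a⟩]
      · rw [ofPath_mul_triv, Pi.single_eq_same, ← ofPath_comp q (QPath.ofArrow a) hq, ← h]
      · intro b _ hb
        rw [Pi.single_eq_of_ne hb, zero_mul]
      · simp
    · refine ⟨0, ?_⟩
      rw [ofPath_mul_ofPath_of_ne p (QPath.triv u) hu]
      simp

end Elements

open IsLocalRing

/-! ### Quotients by weakly admissible ideals. -/

section Quotient

universe u v w

variable {R : Type u} {V : Type w} [CommRing R] [IsLocalRing R] [Fintype V] [Quiver.{v} V]

section Augmentation

open scoped Classical in
variable (R V) in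
/-- The map sending a linear combination of paths to the residue classes of the coefficients of the
trivial paths. -/
def augmentation : PathAlgebra R V →ₐ[R] (V → ResidueField R) :=
  lift (γ := fun _ => 0)
    (CompleteOrthogonalIdempotents.single fun _ : V => ResidueField R) fun _ => mul_zero _

theorem augmentation_apply (x : PathAlgebra R V) (v : V) :
    augmentation R V x v = residue R (coeff (QPath.triv v) x) := by
  classical
  induction x using induction_path with
  | h0 => simp
  | ha x y hx hy => rw [map_add, Pi.add_apply, hx, hy, map_add, map_add]
  | hs r x hx =>
    rw [map_smul, Pi.smul_apply, hx, map_smul, smul_eq_mul, map_mul, Algebra.smul_def]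
    rfl
  | hp p =>
    refine (congrFun (lift_ofPath _ (fun _ => mul_zero _) p) v).trans ?_
    obtain ⟨a, b, p⟩ := p
    cases p with
    | nil =>
      by_cases h : a = v
      · subst h
        have : coeff (R := R) (QPath.triv a) (ofPath R ⟨a, a, Quiver.Path.nil⟩) = 1 :=
          coeff_ofPath_self _
        rw [this, map_one, evalPath, Pi.single_eq_same]
      · rw [evalPath, Pi.single_eq_of_ne (Ne.symm h), coeff_ofPath_of_ne, map_zero]
        exact fun h' => h (congrArg QPath.tail h')
    | cons p c =>
      rw [evalPath, zero_mul, coeff_ofPath_of_ne, map_zero]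
      · rfl
      · intro h
        have := congrArg QPath.length h
        simp [QPath.length, QPath.triv] at this

theorem augmentation_surjective : Surjective (augmentation R V) := by
  intro y
  choose r hr using fun v => residue_surjective (y v)
  refine ⟨∑ v, r v • ofPath R (QPath.triv v), ?_⟩
  ext v
  rw [augmentation_apply, map_sum, Finset.sum_eq_single v]
  · rw [map_smul, coeff_ofPath_self, smul_eq_mul, mul_one, hr]
  · intro w _ hw
    rw [map_smul, coeff_ofPath_of_ne, smul_zero]
    exact fun h => hw (congrArg QPath.tail h)
  · simp

theorem augmentation_eq_zero_iff (x : PathAlgebra R V) :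
    augmentation R V x = 0 ↔ x ∈ arrowIdeal R V ⊔ maxIdealSpan R V := by
  constructor
  · intro h
    have h' : ∀ v, coeff (QPath.triv v) x ∈ maximalIdeal R := fun v => by
      rw [← residue_eq_zero_iff, ← augmentation_apply, h, Pi.zero_apply]
    rw [← sub_add_cancel x (∑ v, coeff (QPath.triv v) x • ofPath R (QPath.triv v))]
    exact Submodule.add_mem_sup (sub_sum_triv_mem_arrowIdeal x)
      (Submodule.sum_mem _ fun v _ => smul_mem_maxIdealSpan (h' v) _)
  · intro h
    obtain ⟨y, hy, z, hz, rfl⟩ := Submodule.mem_sup.1 h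
    ext v
    rw [augmentation_apply, map_add, (mem_arrowIdeal_iff y).1 hy, zero_add, Pi.zero_apply,
      residue_eq_zero_iff]
    exact hz _

end Augmentation

theorem IsBoundedBelow.maxIdealSpan_le {I : Ideal (PathAlgebra R V)} (hI : IsBoundedBelow I) :
    maxIdealSpan R V ≤ I.restrictScalars R ⊔ arrowIdeal R V := by
  obtain ⟨m, n, -, -, -, h⟩ := hI
  refine h.trans (sup_le_sup_left (iSup₂_le fun l hl => ?_) _)
  exact lengthSpan_le_arrowIdeal (Finset.mem_Icc.1 hl).1

variable {I : Ideal (PathAlgebra R V)} [I.IsTwoSided]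

local notation "q" => Ideal.Quotient.mkₐ R I

/-- Modulo `I`, a path of length at least `m` falls into `𝔪Q` and from there into the span of paths
of lengths 1 to `n`; the remaining paths are finitely many. -/
theorem IsBoundedBelow.finite_quotient [∀ u v : V, Finite (u ⟶ v)] (hI : IsBoundedBelow I) :
    Module.Finite R (PathAlgebra R V ⧸ I) := by
  obtain ⟨m, n, hm, -, h1, h2⟩ := hI
  let B : Submodule R (PathAlgebra R V) :=
    (⨆ l ∈ Finset.range m, lengthSpan R V l) ⊔ ⨆ l ∈ Finset.Icc 1 n, lengthSpan R V l
  have hB : B.FG :=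
    (Submodule.fg_biSup _ _ fun l _ => fg_lengthSpan l).sup
      (Submodule.fg_biSup _ _ fun l _ => fg_lengthSpan l)
  have htop : ∀ x, x ∈ I.restrictScalars R ⊔ B := by
    intro x
    induction x using induction_path with
    | h0 => exact zero_mem _
    | ha x y hx hy => exact add_mem hx hy
    | hs r x hx => exact Submodule.smul_mem _ r hx
    | hp p =>
      rcases lt_or_ge p.length m with h | h
      · refine Submodule.mem_sup_right (Submodule.mem_sup_left ?_)
        exact Submodule.mem_iSup_of_mem p.length (Submodule.mem_iSup_of_mem
          (Finset.mem_range.2 h) (Submodule.subset_span ⟨p, rfl, rfl⟩))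
      · have h3 := h1 (ofPath_mem_arrowIdeal_pow hm p h)
        exact (sup_le le_sup_left (h2.trans (sup_le_sup_left le_sup_right _))) h3
  refine ⟨?_⟩
  refine (?_ : Submodule.map (q).toLinearMap B = ⊤) ▸ hB.map (q).toLinearMap
  rw [eq_top_iff]
  rintro y -
  obtain ⟨x, rfl⟩ := Ideal.Quotient.mkₐ_surjective R I y
  obtain ⟨i, hi, b, hb, rfl⟩ := Submodule.mem_sup.1 (htop x)
  refine ⟨b, hb, ?_⟩
  have : q i = 0 := Ideal.Quotient.eq_zero_iff_mem.2 hi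
  rw [map_add, this, zero_add]
  rfl

/-- The map induced by `augmentation` on a quotient. -/
def augmentationQuotient (hI : IsBoundedAbove I) :
    PathAlgebra R V ⧸ I →ₐ[R] (V → ResidueField R) :=
  Ideal.Quotient.liftₐ I (augmentation R V) fun x hx => (augmentation_eq_zero_iff x).2 (hI.1 hx)

theorem augmentationQuotient_mk (hI : IsBoundedAbove I) (x : PathAlgebra R V) :
    augmentationQuotient hI (q x) = augmentation R V x := rfl

theorem augmentationQuotient_surjective (hI : IsBoundedAbove I) :
    Surjective (augmentationQuotient hI) := fun y => by
  obtain ⟨x, rfl⟩ := augmentation_surjective y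
  exact ⟨q x, rfl⟩

/-- A surjection maps the radical into the radical, and `k^V` is semisimple. -/
theorem augmentationQuotient_eq_zero_of_mem_jacobson (hI : IsBoundedAbove I)
    {x : PathAlgebra R V ⧸ I} (hx : x ∈ Ring.jacobson (PathAlgebra R V ⧸ I)) :
    augmentationQuotient hI x = 0 := by
  have : RingHomSurjective (augmentationQuotient hI).toRingHom :=
    ⟨augmentationQuotient_surjective hI⟩
  have h := Ring.le_comap_jacobson (augmentationQuotient hI).toRingHom hx
  rw [IsSemisimpleRing.jacobson_eq_bot] at h
  exact h

theorem exists_mem_arrowIdeal_of_augmentationQuotient_eq_zero (hI : IsWeaklyAdmissible I)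
    {x : PathAlgebra R V ⧸ I} (hx : augmentationQuotient hI.1 x = 0) :
    ∃ y ∈ arrowIdeal R V, q y = x := by
  obtain ⟨z, rfl⟩ := Ideal.Quotient.mkₐ_surjective R I x
  rw [augmentationQuotient_mk, augmentation_eq_zero_iff] at hx
  obtain ⟨i, hi, y, hy, rfl⟩ := Submodule.mem_sup.1
    ((sup_le le_sup_right hI.2.maxIdealSpan_le :
      arrowIdeal R V ⊔ maxIdealSpan R V ≤ I.restrictScalars R ⊔ arrowIdeal R V) hx)
  refine ⟨y, hy, ?_⟩
  have : q i = 0 := Ideal.Quotient.eq_zero_iff_mem.2 hi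
  rw [map_add, this, zero_add]

variable [∀ u v : V, Finite (u ⟶ v)]

/-- Its `m`-th power lands in `𝔪 (RQ/I)`, which is in the radical because the quotient is finite
over `R`. -/
theorem map_arrowIdeal_le_jacobson (hI : IsBoundedBelow I) :
    (arrowIdeal R V).map (q).toLinearMap ≤
      (Ring.jacobson (PathAlgebra R V ⧸ I)).restrictScalars R := by
  have := hI.finite_quotient
  obtain ⟨m, n, -, -, h1, -⟩ := hI
  refine le_jacobson_of_pow_le (m := m) ?_ ?_
  · rintro y _ ⟨b, hb, rfl⟩
    obtain ⟨x, rfl⟩ := Ideal.Quotient.mkₐ_surjective R I y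
    exact ⟨x * b, mul_mem_arrowIdeal_left x hb, map_mul (q) x b⟩
  · rw [← Submodule.map_pow]
    refine (Submodule.map_mono h1).trans ?_
    rw [Submodule.map_sup, maxIdealSpan_eq, Submodule.map_smul'']
    refine sup_le ?_ ((Submodule.smul_mono le_rfl le_top).trans smul_top_le_jacobson)
    rintro _ ⟨x, hx, rfl⟩
    have : q x = 0 := Ideal.Quotient.eq_zero_iff_mem.2 hx
    exact this ▸ zero_mem _

theorem mem_jacobson_quotient_iff (hI : IsWeaklyAdmissible I) {x : PathAlgebra R V ⧸ I} :
    x ∈ Ring.jacobson (PathAlgebra R V ⧸ I) ↔ augmentationQuotient hI.1 x = 0 := by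
  refine ⟨augmentationQuotient_eq_zero_of_mem_jacobson hI.1, fun h => ?_⟩
  obtain ⟨y, hy, rfl⟩ := exists_mem_arrowIdeal_of_augmentationQuotient_eq_zero hI h
  exact map_arrowIdeal_le_jacobson hI.2 ⟨y, hy, rfl⟩

/-- The quotient of `RQ / I` by its radical is a product of copies of the residue field. -/
def quotientQuotientJacobsonEquiv (hI : IsWeaklyAdmissible I) :
    ((PathAlgebra R V ⧸ I) ⧸ Ring.jacobson (PathAlgebra R V ⧸ I)) ≃+* (V → ResidueField R) :=
  quotientJacobsonEquiv (augmentationQuotient hI.1).toRingHom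
    (augmentationQuotient_surjective hI.1) fun _ => mem_jacobson_quotient_iff hI

/-- An idempotent of `k^V` has coordinates 0 and 1, so it lifts to the sum of the vertices with
coordinate 1. -/
theorem isSemiperfect_quotient (hI : IsWeaklyAdmissible I) :
    IsSemiperfect (PathAlgebra R V ⧸ I) := by
  classical
  refine ⟨(quotientQuotientJacobsonEquiv hI).symm.isSemisimpleRing, fun x hx => ?_⟩
  have hx' := (mem_jacobson_quotient_iff hI).1 hx
  have h01 : ∀ v, augmentationQuotient hI.1 x v = 0 ∨ augmentationQuotient hI.1 x v = 1 := by
    intro v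
    have := congrFun hx' v
    rw [map_sub, map_mul, Pi.sub_apply, Pi.mul_apply, Pi.zero_apply, sub_eq_zero] at this
    exact (IsIdempotentElem.iff_eq_zero_or_one).1 this
  let S := Finset.univ.filter fun v => augmentationQuotient hI.1 x v = 1
  refine ⟨∑ v ∈ S, q (ofPath R (QPath.triv v)), ?_, ?_⟩
  · exact ((completeOrthogonalIdempotents_triv (R := R)).map (q).toRingHom).isIdempotentElem_sum
  · rw [mem_jacobson_quotient_iff hI]
    ext v
    rw [map_sub, Pi.sub_apply, Pi.zero_apply, ← map_sum, augmentationQuotient_mk,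
      augmentation_apply, map_sum]
    by_cases h : augmentationQuotient hI.1 x v = 1
    · rw [Finset.sum_eq_single v, coeff_ofPath_self, map_one, h, sub_self]
      · exact fun w _ hw => coeff_ofPath_of_ne fun h => hw (congrArg QPath.tail h)
      · exact fun h' => absurd (Finset.mem_filter.2 ⟨Finset.mem_univ v, h⟩) h'
    · rw [(h01 v).resolve_right h, Finset.sum_eq_zero, map_zero, sub_self]
      refine fun w hw => coeff_ofPath_of_ne fun h' => h ?_
      obtain rfl : w = v := congrArg QPath.tail h'
      exact (Finset.mem_filter.1 hw).2

theorem isBasic_quotient (hI : IsWeaklyAdmissible I) : IsBasic (PathAlgebra R V ⧸ I) := by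
  -- `IsBasic` wants division rings in the universe of the ring and indexed by `Fin n`, hence
  -- `ULift` and the reindexing of `V`.
  refine ⟨isSemiperfect_quotient hI, Fintype.card V, fun _ => ULift.{max v w} (ResidueField R),
    fun _ => inferInstance, ⟨(quotientQuotientJacobsonEquiv hI).trans ?_⟩⟩
  exact (RingEquiv.piCongrRight fun _ => ULift.ringEquiv.symm).trans
    (RingEquiv.piCongrLeft (fun _ => ULift.{max v w} (ResidueField R)) (Fintype.equivFin V))

theorem isGabrielQuiver_quotient (hI : IsWeaklyAdmissible I) :
    IsGabrielQuiver V (PathAlgebra R V ⧸ I) := by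
  classical
  have := hI.2.finite_quotient
  have he : CompleteOrthogonalIdempotents fun v : V => q (ofPath R (QPath.triv v)) :=
    (completeOrthogonalIdempotents_triv (R := R)).map (q).toRingHom
  have hsing : ∀ v, augmentationQuotient hI.1 (q (ofPath R (QPath.triv v))) = Pi.single v 1 :=
    fun v => by
      rw [augmentationQuotient_mk]
      exact lift_triv _ (fun _ => mul_zero _) v
  -- elements of `Γ e_v` are detected modulo the radical by their component at `v`
  have hmem : ∀ v (x : PathAlgebra R V), coeff (QPath.triv v) x ∈ maximalIdeal R →
      q (x * ofPath R (QPath.triv v)) ∈ Ring.jacobson (PathAlgebra R V ⧸ I) := by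
    intro v x hx
    rw [mem_jacobson_quotient_iff hI, map_mul, map_mul, hsing, augmentationQuotient_mk]
    ext w
    by_cases h : w = v
    · subst h
      rw [Pi.mul_apply, augmentation_apply, (residue_eq_zero_iff _).2 hx, zero_mul, Pi.zero_apply]
    · rw [Pi.mul_apply, Pi.single_eq_of_ne h, mul_zero, Pi.zero_apply]
  refine isGabrielQuiver_of_generators he (fun v => ?_) (fun a => q (ofPath R (QPath.ofArrow a)))
    (fun a => map_arrowIdeal_le_jacobson hI.2 ⟨_, ofArrow_mem_arrowIdeal a, rfl⟩)
    (fun a => ?_) (fun a => ?_) (fun u _ x hx => ?_) (fun u _ y hy hsum a => ?_)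
  · refine isLocalIdempotent_of_forall_exists (R := R) (he.idem v) ?_ fun x => ?_
    · intro h
      rw [mem_jacobson_quotient_iff hI, hsing] at h
      have := congrFun h v
      rw [Pi.single_eq_same] at this
      exact one_ne_zero this
    · obtain ⟨x, rfl⟩ := Ideal.Quotient.mkₐ_surjective R I x
      refine ⟨coeff (QPath.triv v) x, ?_⟩
      rw [← map_mul, ← map_smul, ← map_sub]
      have h2 : x * ofPath R (QPath.triv v) - coeff (QPath.triv v) x • ofPath R (QPath.triv v) =
          (x - coeff (QPath.triv v) x • ofPath R (QPath.triv v)) * ofPath R (QPath.triv v) := by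
        rw [sub_mul, smul_mul_assoc, (completeOrthogonalIdempotents_triv (R := R)).idem v]
      rw [h2]
      refine hmem v _ ?_
      rw [map_sub, map_smul, coeff_ofPath_self, smul_eq_mul, mul_one, sub_self]
      exact zero_mem _
  · rw [← map_mul, triv_mul_ofArrow]
  · rw [← map_mul, ofArrow_mul_triv]
  · obtain ⟨z, hz, rfl⟩ := exists_mem_arrowIdeal_of_augmentationQuotient_eq_zero hI
      ((mem_jacobson_quotient_iff hI).1 hx)
    obtain ⟨c, hc⟩ := exists_mul_triv_eq_sum u hz
    refine ⟨fun a => q (c a), ?_⟩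
    rw [← map_mul, hc, map_sum]
    exact Finset.sum_congr rfl fun a _ => map_mul _ _ _
  · choose w hw using fun a => Ideal.Quotient.mkₐ_surjective R I (y a)
    have hz : ∑ a, w a * ofPath R (QPath.ofArrow a.2) ∈ I := by
      have h : q (∑ a, w a * ofPath R (QPath.ofArrow a.2)) = 0 := by
        rw [← hsum, map_sum]
        exact Finset.sum_congr rfl fun a _ => by rw [map_mul, hw]
      exact Ideal.Quotient.eq_zero_iff_mem.1 h
    have hzA : ∑ a, w a * ofPath R (QPath.ofArrow a.2) ∈ arrowIdeal R V :=
      Submodule.sum_mem _ fun a _ => mul_mem_arrowIdeal_left _ (ofArrow_mem_arrowIdeal a.2)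
    -- The lifted relation lies in `I ∩ A ⊆ A² + (𝔪Q ∩ A)`, so its arrow coefficients lie in `𝔪`;
    -- these are the vertex coefficients of the `w a`.
    obtain ⟨s, hs, t, ht, hst⟩ := Submodule.mem_sup.1 (hI.1.2 ⟨hz, hzA⟩)
    have hcoef : coeff (QPath.triv a.1) (w a) ∈ maximalIdeal R := by
      rw [← coeff_ofArrow_sum w a, ← hst, map_add, coeff_ofArrow_of_mem_sq hs, zero_add]
      exact ht.1 _
    have := hmem a.1 (w a) hcoef
    rwa [map_mul, hw, hy] at this

end Quotient

end PathAlgebra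

/-! ### Generators of the radical from projective covers. -/

section SumOfPrincipal

/-- A superfluous submodule lies in every maximal submodule, hence in the radical of the module, and
the coordinate map to `Γ` carries that radical into `J`. -/
theorem IsProjectiveCover.coe_apply_mem_jacobson {Γ ι M : Type*} [Ring Γ] [AddCommGroup M]
    [Module Γ M] {e : ι → Γ}
    {π : (DirectSum ι fun i => mulRightIdeal (⊤ : Ideal Γ) (e i)) →ₗ[Γ] M}
    (hπ : IsProjectiveCover π) {y : DirectSum ι fun i => mulRightIdeal (⊤ : Ideal Γ) (e i)}
    (hy : π y = 0) (i : ι) : (y i : Γ) ∈ Ring.jacobson Γ := by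
  have hker : LinearMap.ker π ≤ Module.jacobson Γ _ := by
    refine le_sInf fun C hC => ?_
    by_contra h
    refine hC.1 (hπ.2.2 C (hC.2 _ (lt_of_le_of_ne le_sup_left fun h' => h ?_)))
    rw [h']
    exact le_sup_right
  exact Module.le_comap_jacobson
    ((mulRightIdeal (⊤ : Ideal Γ) (e i)).subtype.comp (DirectSum.component Γ ι _ i)) (hker hy)

/-- Generators of the radical attached to the arrows of the Gabriel quiver. -/
theorem IsGabrielQuiver.exists_generators {V : Type*} [Quiver V] [Fintype V]
    [∀ u v : V, Finite (u ⟶ v)] {Γ : Type*} [Ring Γ] (h : IsGabrielQuiver V Γ) :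
    ∃ (e : V → Γ) (γ : ∀ {u v : V}, (u ⟶ v) → Γ), CompleteOrthogonalIdempotents e ∧
      (∀ v, IsLocalIdempotent (e v)) ∧
      (∀ {u v : V} (a : u ⟶ v), γ a ∈ Ring.jacobson Γ) ∧
      (∀ {u v : V} (a : u ⟶ v), e v * γ a = γ a) ∧
      (∀ {u v : V} (a : u ⟶ v), γ a * e u = γ a) ∧
      (∀ (u : V) [Fintype (Σ v : V, (u ⟶ v))], ∀ x ∈ Ring.jacobson Γ,
        ∃ c : (Σ v : V, (u ⟶ v)) → Γ, x * e u = ∑ a, c a * γ a.2) ∧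
      ∀ (u : V) [Fintype (Σ v : V, (u ⟶ v))] (y : (Σ v : V, (u ⟶ v)) → Γ),
        (∀ a, y a * e a.1 = y a) → ∑ a, y a * γ a.2 = 0 → ∀ a, y a ∈ Ring.jacobson Γ := by
  classical
  obtain ⟨e, he, hloc, hcov⟩ := h
  choose π hπ using hcov
  let g : ∀ {u v : V} (a : u ⟶ v),
      DirectSum (Σ v : V, (u ⟶ v)) fun a => mulRightIdeal (⊤ : Ideal Γ) (e a.1) :=
    fun {u v} a => DirectSum.lof Γ (Σ v : V, (u ⟶ v))
      (fun a => mulRightIdeal (⊤ : Ideal Γ) (e a.1)) ⟨v, a⟩ (mulRightIdealGen (e v))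
  have hg : ∀ {u v : V} (a : u ⟶ v), e v • g a = g a := fun {u v} a => by
    rw [← map_smul]
    exact congrArg _ (Subtype.ext (he.idem v))
  have hγ : ∀ {u v : V} (a : u ⟶ v), (π u (g a) : Γ) ∈ Ring.jacobson Γ ∧
      (π u (g a) : Γ) * e u = π u (g a) := fun {u v} a =>
    (mem_mulRightIdeal_jacobson (he.idem u)).1 (π u (g a)).2
  have he' : ∀ (u : V) (a : Σ v : V, (u ⟶ v)), IsIdempotentElem (e a.1) := fun u a => he.idem a.1
  refine ⟨e, fun {u v} a => π u (g a), he, hloc, fun a => (hγ a).1, fun {u v} a => ?_,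
    fun a => (hγ a).2, fun u _ x hx => ?_, fun u _ y hy hsum b => ?_⟩
  · rw [← smul_eq_mul, ← SetLike.val_smul, ← map_smul, hg]
  · obtain ⟨y, hy⟩ := (hπ u).2.1 ⟨x * e u, mem_mulRightIdeal.2 ⟨x, hx, rfl⟩⟩
    refine ⟨fun a => y a, ?_⟩
    have := coe_map_directSum_eq_sum (he' u) (π u) y
    rw [hy] at this
    exact this
  · let Y : DirectSum (Σ v : V, (u ⟶ v)) fun a => mulRightIdeal (⊤ : Ideal Γ) (e a.1) :=
      ∑ a, DirectSum.lof Γ _ _ a ⟨y a, (mem_mulRightIdeal_top (he' u a)).2 (hy a)⟩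
    have hY : ∀ a, (Y a : Γ) = y a := fun a => by
      have : DirectSum.component Γ _ _ a Y = ⟨y a, (mem_mulRightIdeal_top (he' u a)).2 (hy a)⟩ := by
        rw [map_sum, Finset.sum_eq_single a, DirectSum.component.lof_self]
        · intro c _ hc
          rw [DirectSum.component.of, dif_neg hc]
        · simp
      exact congrArg Subtype.val this
    have hY0 : π u Y = 0 := Subtype.ext (by
      rw [coe_map_directSum_eq_sum (he' u) (π u) Y]
      simp only [hY]
      exact hsum)
    exact hY b ▸ (hπ u).coe_apply_mem_jacobson hY0 b

end SumOfPrincipal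

/-! ### Scalars modulo the radical over an algebraically closed residue field. -/

section Basic

open IsLocalRing Polynomial

variable {R Γ : Type*} [CommRing R] [Ring Γ] [Algebra R Γ]

theorem exists_eq_of_aeval_prod_eq_zero {D : Type*} [DivisionRing D] (g : Γ →+* D) (x : Γ)
    (s : Multiset R) (h : g (aeval x (s.map fun r => X - C r).prod) = 0) :
    ∃ r, g x = g (algebraMap R Γ r) := by
  induction s using Multiset.induction_on with
  | empty => simp at h
  | cons r s ih =>
    rw [Multiset.map_cons, Multiset.prod_cons, map_mul, map_mul, mul_eq_zero] at h
    rcases h with h | h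
    · refine ⟨r, ?_⟩
      rwa [map_sub, aeval_X, aeval_C, map_sub, sub_eq_zero] at h
    · exact ih h

variable [IsLocalRing R] [Module.Finite R Γ]

/-- Over a local ring with algebraically closed residue field, every element of a finite algebra
acts as a scalar on a division ring quotient. -/
theorem exists_eq_algebraMap_of_isAlgClosed [IsAlgClosed (ResidueField R)] {D : Type*}
    [DivisionRing D] (g : Γ →+* D) (hg : ∀ x ∈ Ring.jacobson Γ, g x = 0) (x : Γ) :
    ∃ r, g x = g (algebraMap R Γ r) := by
  obtain ⟨p, hp, hpx⟩ := IsIntegral.of_finite R x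
  choose σ hσ using residue_surjective (R := R)
  -- Lifts to `R` of the roots of `p` modulo `𝔪`. The product of the factors `X - r` agrees with `p`
  -- modulo `𝔪`, so its value at `x` lies in `J`.
  let s := (p.map (residue R)).roots.map σ
  refine exists_eq_of_aeval_prod_eq_zero g x s ?_
  have hq : ((s.map fun r => X - C r).prod).map (residue R) = p.map (residue R) := by
    rw [Polynomial.map_multiset_prod]
    simp only [s, Multiset.map_map, comp_apply, Polynomial.map_sub, map_X, map_C, hσ]
    exact ((IsAlgClosed.splits (p.map (residue R))).eq_prod_roots_of_monic (hp.map _)).symm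
  have hJ : aeval x ((s.map fun r => X - C r).prod - p) ∈ Ring.jacobson Γ := by
    rw [aeval_eq_sum_range]
    refine Submodule.sum_mem _ fun i _ => smul_mem_jacobson ?_ _
    rw [← residue_eq_zero_iff, ← coeff_map, Polynomial.map_sub, hq, sub_self, coeff_zero]
  have hpx' : aeval x p = 0 := hpx
  rw [map_sub, hpx', sub_zero] at hJ
  exact hg _ hJ

/-- The image of a local idempotent in the product of division rings lives in a single factor, and
on that factor `x` acts as a scalar from `R`. -/
theorem IsLocalIdempotent.exists_sub_smul_mem_jacobson [IsAlgClosed (ResidueField R)]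
    (hΓ : IsBasic Γ) {e : Γ} (he : IsLocalIdempotent e) (x : Γ) :
    ∃ r : R, x * e - r • e ∈ Ring.jacobson Γ := by
  obtain ⟨-, n, D, _, ⟨E⟩⟩ := hΓ
  let f : Γ →+* ∀ i, D i := E.toRingHom.comp (Ideal.Quotient.mk (Ring.jacobson Γ))
  have hf : Surjective f := E.surjective.comp Ideal.Quotient.mk_surjective
  have hJ : ∀ x, f x = 0 ↔ x ∈ Ring.jacobson Γ := fun x => by
    rw [← Ideal.Quotient.eq_zero_iff_mem]
    exact map_eq_zero_iff E E.injective
  obtain ⟨i, hi⟩ : ∃ i, f e i ≠ 0 := by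
    by_contra! h
    exact he.not_mem_jacobson ((hJ e).1 (funext h))
  -- Let `y` lift the unit of the `i`-th factor. Then `y e ∉ J e`, so `J e + Γ y e = Γ e` by
  -- maximality of `J e`; hence modulo `J` the element `e` is a multiple of `y e`, which lives in
  -- factor `i`.
  have hsupp : ∀ j, j ≠ i → f e j = 0 := by
    intro j hj
    obtain ⟨y, hy⟩ := hf (Pi.single i 1)
    have hcov := (he.2 _).2 rfl
    rcases hcov.eq_or_eq (c := mulRightIdeal (Ring.jacobson Γ) e ⊔ Submodule.span Γ {y * e})
      le_sup_left (sup_le hcov.le (by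
        rw [Submodule.span_singleton_le_iff_mem]
        exact mem_mulRightIdeal.2 ⟨y, trivial, rfl⟩)) with h | h
    · exfalso
      have h1 : y * e ∈ mulRightIdeal (Ring.jacobson Γ) e := by
        rw [← h]
        exact Submodule.mem_sup_right (Submodule.mem_span_singleton_self _)
      have h2 := congrFun ((hJ _).2 ((mem_mulRightIdeal_jacobson he.1).1 h1).1) i
      rw [map_mul, hy, Pi.mul_apply, Pi.single_eq_same, one_mul] at h2
      exact hi h2
    · have h1 : e ∈ mulRightIdeal (Ring.jacobson Γ) e ⊔ Submodule.span Γ {y * e} := by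
        rw [h]
        exact (mem_mulRightIdeal_top he.1).2 he.1.eq
      obtain ⟨a, ha, b, hb, hab⟩ := Submodule.mem_sup.1 h1
      obtain ⟨z, rfl⟩ := Submodule.mem_span_singleton.1 hb
      rw [← hab, map_add, (hJ a).2 ((mem_mulRightIdeal_jacobson he.1).1 ha).1, smul_eq_mul,
        map_mul, map_mul, hy]
      simp [Pi.single_eq_of_ne hj]
  obtain ⟨r, hr⟩ := exists_eq_algebraMap_of_isAlgClosed (R := R) ((Pi.evalRingHom D i).comp f)
    (fun x hx => congrFun ((hJ x).2 hx) i) x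
  refine ⟨r, (hJ _).1 (funext fun j => ?_)⟩
  rw [Algebra.smul_def, ← sub_mul, map_mul, Pi.mul_apply, Pi.zero_apply]
  by_cases h : j = i
  · subst h
    rw [map_sub, Pi.sub_apply]
    have hr' : f x j = f (algebraMap R Γ r) j := hr
    rw [hr', sub_self, zero_mul]
  · rw [hsupp j h, mul_zero]

end Basic

namespace PathAlgebra

open IsLocalRing

/-! ### Presenting a basic algebra by its Gabriel quiver. -/

section Presentation

variable {R V Γ : Type*} [CommRing R] [Fintype V] [Quiver V] [Ring Γ] [Algebra R Γ]
  {φ : PathAlgebra R V →ₐ[R] Γ}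

theorem map_arrowIdeal_le_jacobson_of_arrow
    (hφ : ∀ {u v : V} (a : u ⟶ v), φ (ofPath R (QPath.ofArrow a)) ∈ Ring.jacobson Γ) :
    (arrowIdeal R V).map φ.toLinearMap ≤ (Ring.jacobson Γ).restrictScalars R := by
  rw [arrowIdeal_eq, Submodule.map_span, Submodule.span_le]
  rintro _ ⟨_, ⟨p, hp, rfl⟩, rfl⟩
  obtain ⟨v, a, p', hp', h, -⟩ := QPath.exists_eq_comp_ofArrow p hp
  rw [h, ofPath_comp p' (QPath.ofArrow a) hp']
  change φ _ ∈ Ring.jacobson Γ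
  rw [map_mul]
  exact Ideal.mul_mem_left _ _ (hφ a)

variable [IsLocalRing R]

/-- Split `x` by path length: length 0 is absent, length 1 has coefficients in `𝔪`, and longer paths
lie in `A²`. -/
theorem mem_sq_sup_of_coeff_ofArrow_mem {x : PathAlgebra R V} (hx : x ∈ arrowIdeal R V)
    (h : ∀ {u v : V} (a : u ⟶ v), coeff (QPath.ofArrow a) x ∈ maximalIdeal R) :
    x ∈ arrowIdeal R V ^ 2 ⊔ (maxIdealSpan R V ⊓ arrowIdeal R V) := by
  rw [eq_sum_coeff x]
  refine Submodule.sum_mem _ fun p _ => ?_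
  rcases Nat.lt_or_ge p.length 2 with hp | hp
  · rcases Nat.eq_zero_or_pos p.length with h0 | h0
    · rw [QPath.eq_triv_of_length_eq_zero p h0, (mem_arrowIdeal_iff x).1 hx, zero_smul]
      exact zero_mem _
    · refine Submodule.mem_sup_right ⟨smul_mem_maxIdealSpan ?_ _,
        Submodule.smul_mem _ _ (ofPath_mem_arrowIdeal h0)⟩
      obtain ⟨v, a, p', hp', hc, hl⟩ := QPath.exists_eq_comp_ofArrow p h0
      have hpa : p = QPath.ofArrow a := by
        obtain ⟨w, rfl⟩ : ∃ w, p' = QPath.triv w :=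
          ⟨_, QPath.eq_triv_of_length_eq_zero p' (by omega)⟩
        exact hc.trans (QPath.triv_comp _ w hp')
      rw [hpa]
      exact h a
  · exact Submodule.mem_sup_left
      (Submodule.smul_mem _ _ (ofPath_mem_arrowIdeal_pow one_le_two p hp))

variable {e : V → Γ} (he : CompleteOrthogonalIdempotents e)

-- Modulo `J`, `φ x` is `∑ r_v e_v` with `r_v` the vertex coefficients. Multiplying by `e_v`
-- isolates `r_v e_v ∈ J`, and a unit `r_v` would put `e_v` in `J`.
include he in
theorem coeff_triv_mem_of_map_mem_jacobson (heJ : ∀ v, e v ∉ Ring.jacobson Γ)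
    (hφe : ∀ v, φ (ofPath R (QPath.triv v)) = e v)
    (hφA : (arrowIdeal R V).map φ.toLinearMap ≤ (Ring.jacobson Γ).restrictScalars R)
    {x : PathAlgebra R V} (hx : φ x ∈ Ring.jacobson Γ) (v : V) :
    coeff (QPath.triv v) x ∈ maximalIdeal R := by
  have h1 : φ (x - ∑ v, coeff (QPath.triv v) x • ofPath R (QPath.triv v)) ∈ Ring.jacobson Γ :=
    hφA ⟨_, sub_sum_triv_mem_arrowIdeal x, rfl⟩
  have h2 := sub_mem hx h1
  rw [map_sub, sub_sub_cancel, map_sum] at h2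
  have h3 := Ideal.mul_mem_right (e v) _ h2
  rw [Finset.sum_mul, Finset.sum_eq_single v] at h3
  · rw [map_smul, hφe, smul_mul_assoc, (he.idem v).eq] at h3
    exact mem_maximalIdeal_of_smul_mem_jacobson (heJ v) h3
  · intro w _ hw
    rw [map_smul, hφe, smul_mul_assoc, he.ortho hw, smul_zero]
  · simp

variable [∀ u v : V, Finite (u ⟶ v)]

-- For `x ∈ ker φ ∩ A`, writing `x e_u = ∑ c_a a` and applying `φ` gives a relation among the
-- generators. By minimality its coefficients lie in `J`, so the vertex coefficients of the `c_a`,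
-- which are the arrow coefficients of `x`, lie in `𝔪`.
include he in
theorem isBoundedAbove_ker (heJ : ∀ v, e v ∉ Ring.jacobson Γ)
    (hφe : ∀ v, φ (ofPath R (QPath.triv v)) = e v)
    (hφA : (arrowIdeal R V).map φ.toLinearMap ≤ (Ring.jacobson Γ).restrictScalars R)
    (hmin : ∀ (u : V) [Fintype (Σ v : V, (u ⟶ v))] (y : (Σ v : V, (u ⟶ v)) → Γ),
      (∀ a, y a * e a.1 = y a) → ∑ a, y a * φ (ofPath R (QPath.ofArrow a.2)) = 0 →
        ∀ a, y a ∈ Ring.jacobson Γ) :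
    IsBoundedAbove (RingHom.ker φ) := by
  refine ⟨fun x hx => ?_, fun x ⟨hx, hxA⟩ => mem_sq_sup_of_coeff_ofArrow_mem hxA fun {u v} b => ?_⟩
  · have hx0 : φ x ∈ Ring.jacobson Γ := by
      rw [(RingHom.mem_ker).1 hx]
      exact zero_mem _
    rw [← sub_add_cancel x (∑ v, coeff (QPath.triv v) x • ofPath R (QPath.triv v))]
    exact Submodule.add_mem_sup (sub_sum_triv_mem_arrowIdeal x)
      (Submodule.sum_mem _ fun v _ => smul_mem_maxIdealSpan
        (coeff_triv_mem_of_map_mem_jacobson he heJ hφe hφA hx0 v) _)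
  · have := Fintype.ofFinite (Σ v : V, (u ⟶ v))
    obtain ⟨c, hc⟩ := exists_mul_triv_eq_sum u hxA
    have h0 : φ x = 0 := hx
    have hsum : ∑ a, φ (c a * ofPath R (QPath.triv a.1)) * φ (ofPath R (QPath.ofArrow a.2)) = 0 := by
      have := congrArg φ hc
      rw [map_mul, h0, zero_mul, map_sum] at this
      rw [this]
      refine Finset.sum_congr rfl fun a _ => ?_
      rw [← map_mul, mul_assoc, triv_mul_ofArrow]
    have h1 := hmin u (fun a => φ (c a * ofPath R (QPath.triv a.1)))
      (fun a => by rw [map_mul, hφe, mul_assoc, (he.idem a.1).eq]) hsum ⟨v, b⟩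
    have h2 := coeff_triv_mem_of_map_mem_jacobson he heJ hφe hφA h1 v
    have h3 := coeff_ofArrow_sum c ⟨v, b⟩
    rw [← hc] at h3
    rw [← coeff_mul_triv (QPath.ofArrow b) x]
    exact h3 ▸ (congrArg (· ∈ maximalIdeal R) (coeff_mul_triv (QPath.triv v) (c ⟨v, b⟩))).mp h2

variable [Module.Finite R Γ]

include he in
theorem surjective_of_generators (hφe : ∀ v, φ (ofPath R (QPath.triv v)) = e v)
    (hφa : ∀ {u v : V} (a : u ⟶ v), φ (ofPath R (QPath.ofArrow a)) ∈ Ring.jacobson Γ)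
    (hscalar : ∀ v x, ∃ r : R, x * e v - r • e v ∈ Ring.jacobson Γ)
    (hgen : ∀ (u : V) [Fintype (Σ v : V, (u ⟶ v))], ∀ x ∈ Ring.jacobson Γ,
      ∃ c : (Σ v : V, (u ⟶ v)) → Γ, x * e u = ∑ a, c a * φ (ofPath R (QPath.ofArrow a.2))) :
    Surjective φ := by
  let S := LinearMap.range φ.toLinearMap
  let J := (Ring.jacobson Γ).restrictScalars R
  have hsum : ∀ x : Γ, x = ∑ v, x * e v := fun x => by
    rw [← Finset.mul_sum, he.complete, mul_one]
  have h1 : ∀ x, x ∈ S ⊔ J := by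
    intro x
    rw [hsum x]
    refine Submodule.sum_mem _ fun v _ => ?_
    obtain ⟨r, hr⟩ := hscalar v x
    rw [← add_sub_cancel (r • e v) (x * e v)]
    refine Submodule.add_mem_sup ⟨r • ofPath R (QPath.triv v), ?_⟩ hr
    rw [map_smul]
    exact congrArg _ (hφe v)
  -- If `Γ = S + J^n`, then `J = ∑ Γ γ_a ⊆ ∑ (S + J^n) γ_a ⊆ S + J^(n+1)`. The start is `n = 1`,
  -- since `J^0` means `R · 1` here.
  have hn : ∀ n, 1 ≤ n → ∀ x, x ∈ S ⊔ J ^ n := by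
    intro n hn
    induction n, hn using Nat.le_induction with
    | base => simpa using h1
    | succ n hn ih =>
      have hJ : J ≤ S ⊔ J ^ (n + 1) := by
        intro x hx
        rw [hsum x]
        refine Submodule.sum_mem _ fun u _ => ?_
        have := Fintype.ofFinite (Σ v : V, (u ⟶ v))
        obtain ⟨c, hc⟩ := hgen u x hx
        rw [hc]
        refine Submodule.sum_mem _ fun a _ => ?_
        obtain ⟨s, ⟨y, rfl⟩, j, hj, hsj⟩ := Submodule.mem_sup.1 (ih (c a))
        rw [← hsj, add_mul, pow_succ]
        refine Submodule.add_mem_sup ⟨y * ofPath R (QPath.ofArrow a.2), map_mul φ _ _⟩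
          (Submodule.mul_mem_mul hj (hφa a.2))
      exact fun x => (sup_le le_sup_left hJ) (h1 x)
  obtain ⟨n, hn0, hnJ⟩ := exists_jacobson_pow_le_smul_top (R := R) (Γ := Γ)
  have hS : (⊤ : Submodule R Γ) ≤ S :=
    Submodule.le_of_le_smul_of_le_jacobson_bot Module.Finite.fg_top
      (IsLocalRing.maximalIdeal_le_jacobson ⊥)
      fun x _ => (sup_le_sup_left hnJ S) (hn n hn0 x)
  exact fun x => hS (Submodule.mem_top (x := x))

include he in
theorem isBoundedBelow_ker [IsNoetherianRing R] (hsurj : Surjective φ)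
    (hφA : (arrowIdeal R V).map φ.toLinearMap ≤ (Ring.jacobson Γ).restrictScalars R)
    (hgen : ∀ (u : V) [Fintype (Σ v : V, (u ⟶ v))], ∀ x ∈ Ring.jacobson Γ,
      ∃ c : (Σ v : V, (u ⟶ v)) → Γ, x * e u = ∑ a, c a * φ (ofPath R (QPath.ofArrow a.2))) :
    IsBoundedBelow (RingHom.ker φ) := by
  -- Containments in `ker φ + B` may be checked after applying `φ`, that is, inside `Γ`.
  have hlift : ∀ (B : Submodule R (PathAlgebra R V)) (x : PathAlgebra R V),
      φ x ∈ B.map φ.toLinearMap → x ∈ (RingHom.ker φ).restrictScalars R ⊔ B := by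
    rintro B x ⟨b, hb, h⟩
    rw [← sub_add_cancel x b]
    refine Submodule.add_mem_sup ?_ hb
    change φ (x - b) = 0
    rw [map_sub, sub_eq_zero]
    exact h.symm
  have hm : (maxIdealSpan R V).map φ.toLinearMap = maximalIdeal R • (⊤ : Submodule R Γ) := by
    rw [maxIdealSpan_eq, Submodule.map_smul'', Submodule.map_top,
      LinearMap.range_eq_top.2 hsurj]
  have hJA : ∀ x ∈ Ring.jacobson Γ, x ∈ (arrowIdeal R V).map φ.toLinearMap := by
    intro x hx
    rw [← mul_one x, ← he.complete, Finset.mul_sum]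
    refine Submodule.sum_mem _ fun u _ => ?_
    have := Fintype.ofFinite (Σ v : V, (u ⟶ v))
    obtain ⟨c, hc⟩ := hgen u x hx
    rw [hc]
    refine Submodule.sum_mem _ fun a _ => ?_
    obtain ⟨w, hw⟩ := hsurj (c a)
    exact ⟨w * ofPath R (QPath.ofArrow a.2),
      mul_mem_arrowIdeal_left w (ofArrow_mem_arrowIdeal a.2), by rw [← hw]; exact map_mul φ _ _⟩
  obtain ⟨m, hm0, hmJ⟩ := exists_jacobson_pow_le_smul_top (R := R) (Γ := Γ)
  -- The images of the spans of paths of lengths 1 to `n` form an ascending chain in the noetherian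
  -- `R`-module `Γ`. Where it stabilizes, it contains the whole image of `A`, which bounds the
  -- length in the second containment.
  let B : ℕ →o Submodule R Γ :=
    { toFun := fun n => (⨆ l ∈ Finset.Icc 1 n, lengthSpan R V l).map φ.toLinearMap
      monotone' := fun i j hij => Submodule.map_mono
        (biSup_mono fun l hl => Finset.Icc_subset_Icc_right hij hl) }
  obtain ⟨n, hn⟩ := monotone_stabilizes_iff_noetherian.2
    (isNoetherian_of_isNoetherianRing_of_finite R Γ) B
  have hAB : (arrowIdeal R V).map φ.toLinearMap ≤ B (n + 1) := by
    rw [arrowIdeal, Submodule.map_iSup]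
    refine iSup_le fun l => ?_
    rw [Submodule.map_iSup]
    refine iSup_le fun hl => ?_
    rw [← hn (n + 1) n.le_succ, hn (max n l) (le_max_left _ _)]
    exact Submodule.map_mono (le_iSup₂_of_le l
      (Finset.mem_Icc.2 ⟨hl, le_max_right _ _⟩) le_rfl)
  refine ⟨m, n + 1, hm0, n.succ_pos, fun x hx => hlift _ x ?_, fun x hx => hlift _ x ?_⟩
  · rw [hm]
    refine hmJ (pow_le_pow_left' hφA m ?_)
    rw [← Submodule.map_pow]
    exact ⟨x, hx, rfl⟩
  · refine hAB (hJA _ (smul_top_le_jacobson (R := R) ?_))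
    rw [← hm]
    exact ⟨x, hx, rfl⟩

theorem exists_surjective_isWeaklyAdmissible_ker [IsNoetherianRing R]
    [IsAlgClosed (ResidueField R)] (hΓ : IsBasic Γ) (hQ : IsGabrielQuiver V Γ) :
    ∃ φ : PathAlgebra R V →ₐ[R] Γ, Surjective φ ∧ IsWeaklyAdmissible (RingHom.ker φ) := by
  obtain ⟨e, γ, he, hloc, hγ, hl, hr, hgen, hmin⟩ := hQ.exists_generators
  let φ := lift (R := R) he hl
  have hφe : ∀ v, φ (ofPath R (QPath.triv v)) = e v := lift_triv he hl
  have hφa : ∀ {u v : V} (a : u ⟶ v), φ (ofPath R (QPath.ofArrow a)) = γ a :=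
    fun a => lift_ofArrow he hl a (hr a)
  have hφJ : ∀ {u v : V} (a : u ⟶ v), φ (ofPath R (QPath.ofArrow a)) ∈ Ring.jacobson Γ :=
    fun a => hφa a ▸ hγ a
  have hφA := map_arrowIdeal_le_jacobson_of_arrow hφJ
  simp only [← hφa] at hgen hmin
  have hsurj := surjective_of_generators he hφe hφJ
    (fun v => (hloc v).exists_sub_smul_mem_jacobson hΓ) hgen
  exact ⟨φ, hsurj, isBoundedAbove_ker he (fun v => (hloc v).not_mem_jacobson) hφe hφA hmin,
    isBoundedBelow_ker he hsurj hφA hgen⟩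

end Presentation

/-- The structure map of `Γ` factors through `RQ/ker φ`, so its injectivity passes to `R → RQ/ker
φ`. -/
theorem isAdmissible_ker {R V Γ : Type*} [CommRing R] [IsLocalRing R] [Fintype V] [Quiver V]
    [Ring Γ] [Algebra R Γ] {φ : PathAlgebra R V →ₐ[R] Γ} (h : IsWeaklyAdmissible (RingHom.ker φ))
    (hinj : Injective (algebraMap R Γ)) : IsAdmissible (RingHom.ker φ) := by
  refine ⟨h, fun r s hrs => hinj ?_⟩
  have : algebraMap R (PathAlgebra R V) r - algebraMap R (PathAlgebra R V) s ∈ RingHom.ker φ :=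
    Ideal.Quotient.eq.1 hrs
  rw [RingHom.mem_ker, map_sub, sub_eq_zero] at this
  rwa [AlgHom.commutes, AlgHom.commutes] at this

end PathAlgebra

end

theorem mainTheorem7 {R : Type*} [CommRing R] [IsLocalRing R] [IsNoetherianRing R]
    [IsAdicComplete (IsLocalRing.maximalIdeal R) R]
    [IsAlgClosed (IsLocalRing.ResidueField R)]
    {V : Type*} [Fintype V] [Quiver V] [∀ u v : V, Finite (u ⟶ v)] :
    (∀ (Γ : Type*) [Ring Γ] [Algebra R Γ] [Module.Finite R Γ],
      IsBasic Γ → IsGabrielQuiver V Γ →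
        ∃ φ : PathAlgebra R V →ₐ[R] Γ, Function.Surjective φ ∧
          PathAlgebra.IsWeaklyAdmissible (RingHom.ker φ) ∧
          (Function.Injective (algebraMap R Γ) → PathAlgebra.IsAdmissible (RingHom.ker φ))) ∧
    (∀ (I : Ideal (PathAlgebra R V)) [I.IsTwoSided], PathAlgebra.IsWeaklyAdmissible I →
      Module.Finite R (PathAlgebra R V ⧸ I) ∧
        IsSemiperfect (PathAlgebra R V ⧸ I) ∧
        IsBasic (PathAlgebra R V ⧸ I) ∧
        IsGabrielQuiver V (PathAlgebra R V ⧸ I)) := by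
  refine ⟨fun Γ _ _ _ hΓ hQ => ?_, fun I _ hI => ?_⟩
  · obtain ⟨φ, hφ, hker⟩ :=
      PathAlgebra.exists_surjective_isWeaklyAdmissible_ker (R := R) hΓ hQ
    exact ⟨φ, hφ, hker, PathAlgebra.isAdmissible_ker hker⟩
  · exact ⟨hI.2.finite_quotient, PathAlgebra.isSemiperfect_quotient hI,
      PathAlgebra.isBasic_quotient hI, PathAlgebra.isGabrielQuiver_quotient hI⟩
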